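/- Let $n\ge 2$, $q=2^n$, $1\le k<n$, $e=\gcd(k,n)$, and suppose that $n/e$ is odd. Let $F(x)=x^{2^k+1}$ on $\mathbb F_q$ and let $c\in\mathbb F_{2^n}\setminus\mathbb F_{2^e}$. For $a,b\in\mathbb F_q$ let ${}_c\mathcal B_F(a,b)$ be the number of $(x,y)\in\mathbb F_q^2$ with $F(x)-cF(y)=b$ and $F(x+a)-c^{-1}F(y+a)=b$, and let $\beta_{F,c}=\max_{a,b\in\mathbb F_q^*}{}_c\mathcal B_F(a,b)$ be the $c$-boomerang uniformity of $F$. For $(\alpha,\beta)\in\mathbb F_q^2$ put $$A=\alpha+\beta,\quad B=\beta^{2^{n-k}}+\beta,\quad A'=c\alpha+c^{-1}\beta,\quad B'=(c^{-1}\beta)^{2^{n-k}}+c^{-1}\beta,$$ and let $\gamma,\gamma'\in\mathbb F_q$ be the unique elements with $\gamma^{2^k+1}=A$ and $(\gamma')^{2^k+1}=A'$. Let $\mathrm{Tr}_e$ be the relative trace from $\mathbb F_{2^n}$ to $\mathbb F_{2^e}$, and let $$\mathcal A=\{(\alpha,\beta)\in\mathbb F_q^2:\alpha=\beta\in\mathbb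 F_{2^e}\},\qquad \mathcal A'=\{(\alpha,\beta)\in\mathbb F_q^2: c\alpha=c^{-1}\beta\in\mathbb F_{2^e}\},$$ $$\mathcal F=\{(\alpha,\beta)\in\mathbb F_q^2: A\ne0,\ B\neq 0,\ \mathrm{Tr}_e(B\gamma^{-1})=1\},\qquad \mathcal F'=\{(\alpha,\beta)\in\mathbb F_q^2: A'\ne 0,\ B'\neq 0,\ \mathrm{Tr}_e(B'(\gamma')^{-1})=1\}.$$ Then $$\beta_{F,c}\le 1+\left(\frac{2}{n/e}\right)^{e} 2^{\frac{e-n}{2}}\,\bigl|(\mathcal A\cap\mathcal F')\cup(\mathcal A'\cap\mathcal F)\bigr|+2^{e-n}\,|\mathcal F\cap\mathcal F'|,$$ where $\left(\frac{2}{n/e}\right)$ is the Jacobi symbol. -/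

import Mathlib

namespace CBoomerang

/-- The entry at `(a, b)` of the `c`-boomerang connectivity table of `F : K → K`: the number of
pairs `(x, y)` with `F x - c F y = b` and `F (x + a) - c⁻¹ F (y + a) = b`. -/
noncomputable def cBCT {K : Type*} [Field K] (F : K → K) (c a b : K) : ℕ :=
  Set.ncard {p : K × K | F p.1 - c * F p.2 = b ∧ F (p.1 + a) - c⁻¹ * F (p.2 + a) = b}

/-- The `c`-boomerang uniformity of `F : K → K`, for a finite field `K`: the largest entry
`cBCT F c a b` with `a` and `b` nonzero. -/
noncomputable def cBoomerangUniformity {K : Type*} [Field K] (F : K → K) (c : K) : ℕ :=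
  sSup {m : ℕ | ∃ a b : K, a ≠ 0 ∧ b ≠ 0 ∧ m = cBCT F c a b}

/-- Over a finite field the supremum in `cBoomerangUniformity`
is attained, so it is a maximum. -/
theorem isGreatest_cBoomerangUniformity {K : Type*} [Field K] [Finite K] (F : K → K) (c : K) :
    IsGreatest {m : ℕ | ∃ a b : K, a ≠ 0 ∧ b ≠ 0 ∧ m = cBCT F c a b}
      (cBoomerangUniformity F c) := by
  have hfin : {m : ℕ | ∃ a b : K, a ≠ 0 ∧ b ≠ 0 ∧ m = cBCT F c a b}.Finite := by
    refine (Set.finite_range fun p : K × K => cBCT F c p.1 p.2).subset ?_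
    rintro m ⟨a, b, -, -, rfl⟩
    exact ⟨(a, b), rfl⟩
  exact ⟨Nat.sSup_mem ⟨_, 1, 1, one_ne_zero, one_ne_zero, rfl⟩ hfin.bddAbove,
    fun m hm => le_csSup hfin.bddAbove hm⟩

/-- The subfield `𝔽_{2^e}` of a field `K` of characteristic two: the elements `x` with
`x ^ (2 ^ e) = x`. If `K` has `2 ^ n` elements and `e` divides `n`, it has `2 ^ e` elements. -/
def subfieldTwoPow (K : Type*) [Field K] [CharP K 2] (e : ℕ) : Subfield K where
  carrier := {x | x ^ 2 ^ e = x}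
  mul_mem' {x y} hx hy := by
    simp only [Set.mem_ofPred_eq] at *
    rw [mul_pow, hx, hy]
  one_mem' := one_pow _
  add_mem' {x y} hx hy := by
    simp only [Set.mem_ofPred_eq] at *
    rw [add_pow_char_pow, hx, hy]
  zero_mem' := zero_pow (pow_ne_zero _ two_ne_zero)
  neg_mem' {x} hx := by
    simp only [Set.mem_ofPred_eq, CharTwo.neg_eq] at *
    exact hx
  inv_mem' x hx := by
    simp only [Set.mem_ofPred_eq] at *
    rw [inv_pow, hx]

/-- The relative trace `Tr_e` from `K` to its subfield `𝔽_{2^e}`. -/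
noncomputable def trE {K : Type*} [Field K] [CharP K 2] (e : ℕ) (x : K) : subfieldTwoPow K e :=
  Algebra.trace (subfieldTwoPow K e) K x

/-- The set `𝒜` of the pairs `(α, β)` with `α = β ∈ 𝔽_{2^e}`. -/
def setA (K : Type*) [Field K] [CharP K 2] (e : ℕ) : Set (K × K) :=
  {p | p.1 = p.2 ∧ p.2 ∈ subfieldTwoPow K e}

/-- The set `𝒜'` of the pairs `(α, β)` with `c α = c⁻¹ β ∈ 𝔽_{2^e}`. -/
def setA' {K : Type*} [Field K] [CharP K 2] (e : ℕ) (c : K) : Set (K × K) :=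
  {p | c * p.1 = c⁻¹ * p.2 ∧ c⁻¹ * p.2 ∈ subfieldTwoPow K e}

/-- The condition `A ≠ 0`, `B ≠ 0` and `Tr_e (B γ⁻¹) = 1`, where `γ` is the
`(2^k+1)`-st root of `A`. (The root exists and is unique when `x ↦ x ^ (2 ^ k + 1)` is a bijection
of `K`, which is the case for `K` with `2 ^ n` elements and `n / gcd k n` odd.) -/
def TraceCond {K : Type*} [Field K] [CharP K 2] (k e : ℕ) (A B : K) : Prop :=
  A ≠ 0 ∧ B ≠ 0 ∧ ∃ γ : K, γ ^ (2 ^ k + 1) = A ∧ trE e (B * γ⁻¹) = 1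

/-- The set `ℱ` of the pairs `(α, β)` that satisfy the trace condition for `A = α + β` and
`B = β ^ (2 ^ (n - k)) + β`. -/
def setF (K : Type*) [Field K] [CharP K 2] (n k e : ℕ) : Set (K × K) :=
  {p | TraceCond k e (p.1 + p.2) (p.2 ^ 2 ^ (n - k) + p.2)}

/-- The set `ℱ'` of the pairs `(α, β)` that satisfy the trace condition for
`A' = c α + c⁻¹ β` and `B' = (c⁻¹ β) ^ (2 ^ (n - k)) + c⁻¹ β`. -/
def setF' {K : Type*} [Field K] [CharP K 2] (n k e : ℕ) (c : K) : Set (K × K) :=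
  {p | TraceCond k e (c * p.1 + c⁻¹ * p.2) ((c⁻¹ * p.2) ^ 2 ^ (n - k) + c⁻¹ * p.2)}

end CBoomerang

set_option linter.unusedSectionVars false

namespace CBoomerang

open Finset

/-! Write N = (n + e) / 2, q = 2^n and χ for the canonical additive character. Homogeneity reduces a
to 1. Orthogonality turns the entry at (1, b), times q², into the sum over frequencies (α, β) of
χ(b(α + β)) S(α, β) S(cα, c⁻¹β), where S is `pairSum`. Up to sign, S(α, β) is the Weil sum of A
x^(2^k+1) + B x. If A = 0, its absolute value is q or 0 according to whether β lies in 𝔽_{2^e}; if A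
≠ 0, its square is 2^(n+e) or 0 according to the trace condition (`goldSum_sq`). So the zero
frequency contributes q², the mixed ones at most q·2^N in absolute value, the generic ones exactly
2^(n+e), and all others vanish. The triangle inequality settles the case where the e-th power of the
Jacobi symbol is 1.

If that power is -1, then e is odd and, after division by q, a further 2·2^N must be gained for each
mixed frequency. There are at most two of these (`ncard_mixedSet_le`). On the line β = cα both
factors S coincide, so χ(b(α + β)) decides the sign; a Weil sum shows that almost half of the
generic frequencies there, at least, contribute negatively (`exists_neg_frequencies`). This gains
2^n - 2^N, which exceeds 4·2^N once n ≥ N + 3. Only e = 1 with n = 3 or n = 5 remain: for n = 5 the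
generic count is divisible by 8 and rounding closes the gap; for n = 3 the generic count is at least
8, and a finite check in 𝔽_8 bounds every entry by 2. -/

/-- The hypotheses on the exponent `2 ^ k + 1` of the Gold function. -/
structure GoldHyp (K : Type*) [Field K] (n k e : ℕ) : Prop where
  card : Nat.card K = 2 ^ n
  one_le : 1 ≤ k
  lt : k < n
  gcd : e = Nat.gcd k n
  odd : Odd (n / e)

/-! ### Frobenius powers, the subfield 𝔽_{2^e} and the Gold permutation. -/

section Frobenius

variable {K : Type*} [Field K] [CharP K 2] {n k e : ℕ}

theorem mem_subfieldTwoPow {x : K} : x ∈ subfieldTwoPow K e ↔ x ^ 2 ^ e = x := Iff.rfl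

theorem add_pow_two_pow (x y : K) (j : ℕ) : (x + y) ^ 2 ^ j = x ^ 2 ^ j + y ^ 2 ^ j :=
  add_pow_char_pow x y 2 j

theorem pow_two_pow_gcd {x : K} {i j : ℕ} (hi : x ^ 2 ^ i = x) (hj : x ^ 2 ^ j = x) :
    x ^ 2 ^ Nat.gcd i j = x := by
  have h : Function.IsPeriodicPt (frobenius K 2) (Nat.gcd i j) x := by
    apply Function.IsPeriodicPt.gcd <;>
      simpa [Function.IsPeriodicPt, Function.IsFixedPt, iterate_frobenius]
  simpa [Function.IsPeriodicPt, Function.IsFixedPt, iterate_frobenius] using h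

theorem pow_two_pow_mul {x : K} {i : ℕ} (hi : x ^ 2 ^ i = x) (j : ℕ) : x ^ 2 ^ (i * j) = x := by
  induction j with
  | zero => simp
  | succ j ih => rw [Nat.mul_succ, pow_add, pow_mul, ih, hi]

theorem pow_two_pow_of_dvd {x : K} {i j : ℕ} (hi : x ^ 2 ^ i = x) (hij : i ∣ j) :
    x ^ 2 ^ j = x := by
  obtain ⟨l, rfl⟩ := hij
  exact pow_two_pow_mul hi l

theorem add_self (x : K) : x + x = 0 := CharTwo.add_self_eq_zero x

theorem eq_of_add_eq_zero {x y : K} (h : x + y = 0) : x = y := CharTwo.add_eq_zero.mp h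

namespace GoldHyp

theorem pos (h : GoldHyp K n k e) : 0 < e := h.gcd ▸ Nat.gcd_pos_of_pos_left _ h.one_le

theorem dvd_k (h : GoldHyp K n k e) : e ∣ k := h.gcd ▸ Nat.gcd_dvd_left _ _

theorem dvd_n (h : GoldHyp K n k e) : e ∣ n := h.gcd ▸ Nat.gcd_dvd_right _ _

theorem pow_card (h : GoldHyp K n k e) [Finite K] (x : K) : x ^ 2 ^ n = x := by
  have := Fintype.ofFinite K
  rw [← h.card, Nat.card_eq_fintype_card, FiniteField.pow_card]

/-- Since n / e is odd, doubling k creates no new common factor with n. Hence the 2^k-Frobenius and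
its inverse agree only on 𝔽_{2^e}. -/
theorem gcd_two_mul (h : GoldHyp K n k e) : Nat.gcd (2 * k) n = e := by
  obtain ⟨a, ha⟩ := h.dvd_k
  obtain ⟨m, hm⟩ := h.dvd_n
  have hpos := h.pos
  have hodd := h.odd
  rw [hm, Nat.mul_div_cancel_left _ hpos] at hodd
  have hg := h.gcd
  rw [ha, hm, Nat.gcd_mul_left] at hg
  have hg1 : Nat.gcd a m = 1 := Nat.eq_of_mul_eq_mul_left hpos (by rw [← hg, mul_one])
  rw [ha, hm, ← mul_assoc, mul_comm 2 e, mul_assoc, Nat.gcd_mul_left]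
  have : Nat.Coprime (2 * a) m :=
    Nat.Coprime.mul_left (Nat.coprime_two_left.mpr hodd) hg1
  rw [this, mul_one]

theorem mem_of_pow_k (h : GoldHyp K n k e) [Finite K] {x : K} (hx : x ^ 2 ^ k = x) :
    x ∈ subfieldTwoPow K e := by
  have := pow_two_pow_gcd hx (h.pow_card x)
  rwa [← h.gcd] at this

theorem mem_of_pow_two_mul_k (h : GoldHyp K n k e) [Finite K] {x : K}
    (hx : x ^ 2 ^ (2 * k) = x) : x ∈ subfieldTwoPow K e := by
  have := pow_two_pow_gcd hx (h.pow_card x)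
  rwa [h.gcd_two_mul] at this

theorem pow_k_of_mem (h : GoldHyp K n k e) {x : K} (hx : x ∈ subfieldTwoPow K e) :
    x ^ 2 ^ k = x :=
  pow_two_pow_of_dvd hx h.dvd_k

theorem pow_sub_of_mem (h : GoldHyp K n k e) {x : K} (hx : x ∈ subfieldTwoPow K e) :
    x ^ 2 ^ (n - k) = x :=
  pow_two_pow_of_dvd hx (Nat.dvd_sub h.dvd_n h.dvd_k)

theorem pow_sub_pow (h : GoldHyp K n k e) [Finite K] (x : K) :
    (x ^ 2 ^ (n - k)) ^ 2 ^ k = x := by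
  rw [← pow_mul, ← pow_add, Nat.sub_add_cancel h.lt.le, h.pow_card]

theorem pow_pow_sub (h : GoldHyp K n k e) [Finite K] (x : K) :
    (x ^ 2 ^ k) ^ 2 ^ (n - k) = x := by
  rw [← pow_mul, ← pow_add, Nat.add_sub_cancel' h.lt.le, h.pow_card]

theorem pow_sub_add_self_eq_zero (h : GoldHyp K n k e) [Finite K] {x : K} :
    x ^ 2 ^ (n - k) + x = 0 ↔ x ∈ subfieldTwoPow K e := by
  refine ⟨fun hx => h.mem_of_pow_k ?_, fun hx => by rw [h.pow_sub_of_mem hx, add_self]⟩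
  conv_lhs => rw [← eq_of_add_eq_zero hx]
  exact h.pow_sub_pow x

/-- A quotient z of two preimages has z^(2^k) = z⁻¹, hence z^(2^(2k)) = z and z ∈ 𝔽_{2^e}. There the
exponent 2^k + 1 acts as squaring, which is injective in characteristic two. -/
theorem gold_injective (h : GoldHyp K n k e) [Finite K] :
    Function.Injective fun x : K => x ^ (2 ^ k + 1) := by
  intro x y hxy
  simp only at hxy
  by_cases hy : y = 0
  · subst hy
    rw [zero_pow (by positivity)] at hxy
    exact pow_eq_zero_iff (by positivity) |>.mp hxy
  have hz : (x / y) ^ (2 ^ k + 1) = 1 := by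
    rw [div_pow, hxy, div_self (pow_ne_zero _ hy)]
  set z := x / y with hzdef
  have hz0 : z ≠ 0 := by
    rintro h0
    rw [h0, zero_pow (by positivity)] at hz
    exact zero_ne_one hz
  have h1 : z ^ 2 ^ k = z⁻¹ := by
    rw [pow_succ] at hz
    exact eq_inv_of_mul_eq_one_left hz
  have h2 : z ∈ subfieldTwoPow K e := h.mem_of_pow_two_mul_k (by
    rw [two_mul, pow_add, pow_mul, h1, inv_pow, h1, inv_inv])
  have h3 : z ^ 2 = 1 := by
    rw [pow_succ, h.pow_k_of_mem h2] at hz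
    rw [sq, hz]
  have h4 : z = 1 := by
    have : (z + 1) ^ 2 = 0 := by
      rw [CharTwo.add_sq, h3, one_pow, add_self]
    exact eq_of_add_eq_zero (pow_eq_zero_iff two_ne_zero |>.mp this)
  rw [hzdef, div_eq_one_iff_eq hy] at h4
  exact h4

theorem exists_root (h : GoldHyp K n k e) [Finite K] (A : K) : ∃ γ : K, γ ^ (2 ^ k + 1) = A :=
  (Finite.injective_iff_surjective.mp h.gold_injective) A

/-- The units of the subfield are the (2^e - 1)-torsion of the cyclic group Kˣ. -/
theorem card_subfield (h : GoldHyp K n k e) [Finite K] :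
    Nat.card (subfieldTwoPow K e) = 2 ^ e := by
  have := Fintype.ofFinite K
  classical
  have hk : Nat.card (powMonoidHom (2 ^ e - 1) : Kˣ →* Kˣ).ker = 2 ^ e - 1 := by
    rw [IsCyclic.card_powMonoidHom_ker, Nat.card_units, h.card, Nat.pow_sub_one_gcd_pow_sub_one,
      Nat.gcd_eq_right h.dvd_n]
  have he : 2 ^ e - 1 + 1 = 2 ^ e := Nat.sub_add_cancel Nat.one_le_two_pow
  have hequiv : (powMonoidHom (2 ^ e - 1) : Kˣ →* Kˣ).ker ≃ (subfieldTwoPow K e)ˣ :=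
    { toFun := fun u => Units.mk0 ⟨(u.1 : K), by
          have := congrArg Units.val (MonoidHom.mem_ker.mp u.2)
          simp only [powMonoidHom_apply, Units.val_pow_eq_pow_val, Units.val_one] at this
          exact mem_subfieldTwoPow.mpr (by
            simpa only [pow_sub_one_mul (pow_ne_zero e two_ne_zero), one_mul] using
              congrArg (· * (u.1 : K)) this)⟩
            (fun h0 => u.1.ne_zero (congrArg Subtype.val h0))
      invFun := fun u => ⟨Units.mk0 (u.1 : K) (fun h0 => u.ne_zero (Subtype.ext h0)), by
          rw [MonoidHom.mem_ker]
          ext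
          simp only [powMonoidHom_apply, Units.val_pow_eq_pow_val, Units.val_one, Units.val_mk0]
          have h0 : (u.1 : K) ≠ 0 := fun h0 => u.ne_zero (Subtype.ext h0)
          have := mem_subfieldTwoPow.mp u.1.2
          rw [← he, pow_succ] at this
          exact mul_right_cancel₀ h0 (by rw [this, one_mul])⟩
      left_inv := fun u => by ext; rfl
      right_inv := fun u => by ext; rfl }
  have h1 : Nat.card (subfieldTwoPow K e)ˣ = 2 ^ e - 1 := by rw [← Nat.card_congr hequiv, hk]
  rw [Nat.card_units] at h1
  have h2 : 0 < Nat.card (subfieldTwoPow K e) := Nat.card_pos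
  omega

theorem finrank (h : GoldHyp K n k e) [Finite K] :
    Module.finrank (subfieldTwoPow K e) K = n / e := by
  have := Module.natCard_eq_pow_finrank (K := subfieldTwoPow K e) (V := K)
  rw [h.card, h.card_subfield, ← pow_mul] at this
  have := Nat.pow_right_injective (le_refl 2) this
  exact (Nat.div_eq_of_eq_mul_right h.pos this).symm

theorem trE_one (h : GoldHyp K n k e) [Finite K] : trE e (1 : K) = 1 := by
  have h1 : trE e (1 : K) = ((n / e : ℕ) : subfieldTwoPow K e) := by
    have := Algebra.trace_algebraMap (R := subfieldTwoPow K e) (S := K) 1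
    rw [h.finrank, map_one, nsmul_one] at this
    exact this
  rw [h1]
  obtain ⟨j, hj⟩ := h.odd
  rw [hj, Nat.cast_add, Nat.cast_mul]
  simp [CharTwo.two_eq_zero]

end GoldHyp

end Frobenius

/-! ### The canonical additive character and the relative trace. -/

section Character

variable {K : Type*} [Field K] [CharP K 2]

/-- The canonical additive character `x ↦ (-1) ^ Tr x`. -/
noncomputable def chi (K : Type*) [Field K] [CharP K 2] : AddChar K ℝ :=
  letI := ZMod.algebra K 2
  (AddChar.zmodChar 2 (ζ := (-1 : ℝ)) (by norm_num)).compAddMonoidHom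
    (Algebra.trace (ZMod 2) K).toAddMonoidHom

theorem chi_add (x y : K) : chi K (x + y) = chi K x * chi K y := AddChar.map_add_eq_mul _ _ _

theorem chi_zero : chi K 0 = 1 := AddChar.map_zero_eq_one _

theorem chi_eq_one_or (x : K) : chi K x = 1 ∨ chi K x = -1 := by
  let := ZMod.algebra K 2
  have : chi K x = (-1 : ℝ) ^ (Algebra.trace (ZMod 2) K x).val := rfl
  rw [this]
  exact neg_one_pow_eq_or _ _

theorem chi_eq_one_iff (x : K) :
    chi K x = 1 ↔ @Algebra.trace (ZMod 2) K _ _ (ZMod.algebra K 2) x = 0 := by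
  let := ZMod.algebra K 2
  have : chi K x = (-1 : ℝ) ^ (Algebra.trace (ZMod 2) K x).val := rfl
  rw [this]
  generalize Algebra.trace (ZMod 2) K x = t
  have h0 : ∀ t : ZMod 2, t = 0 ∨ t = 1 := by decide
  have hv : (1 : ZMod 2).val = 1 := rfl
  rcases h0 t with rfl | rfl
  · simp
  · rw [hv]
    norm_num

theorem chi_mul_self (x : K) : chi K x * chi K x = 1 := by
  rcases chi_eq_one_or x with h | h <;> rw [h] <;> norm_num

theorem chi_sq [Finite K] (x : K) : chi K (x ^ 2) = chi K x := by
  let := ZMod.algebra K 2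
  have h := Algebra.trace_eq_of_algEquiv
    (FiniteField.frobeniusAlgEquivOfAlgebraic (ZMod 2) K) x
  have h2 : (FiniteField.frobeniusAlgEquivOfAlgebraic (ZMod 2) K) x = x ^ 2 := by
    have := congrFun (FiniteField.coe_frobeniusAlgEquivOfAlgebraic (ZMod 2) K) x
    rw [ZMod.card] at this
    exact this
  rw [h2] at h
  have e1 : ∀ y : K, chi K y = (-1 : ℝ) ^ (Algebra.trace (ZMod 2) K y).val := fun _ => rfl
  rw [e1, e1, h]

theorem chi_pow_two_pow [Finite K] (x : K) (j : ℕ) : chi K (x ^ 2 ^ j) = chi K x := by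
  induction j with
  | zero => simp
  | succ j ih => rw [pow_succ, pow_mul, chi_sq, ih]

theorem exists_chi_ne_one [Finite K] : ∃ x : K, chi K x ≠ 1 := by
  let := ZMod.algebra K 2
  obtain ⟨x, hx⟩ := Algebra.trace_surjective (ZMod 2) K 1
  refine ⟨x, fun h => ?_⟩
  rw [chi_eq_one_iff] at h
  exact one_ne_zero (hx.symm.trans h)

theorem sum_chi_mul [Fintype K] [DecidableEq K] (a : K) :
    ∑ x : K, chi K (x * a) = if a = 0 then (Fintype.card K : ℝ) else 0 := by
  have hprim : (chi K).IsPrimitive := AddChar.IsPrimitive.of_ne_one (by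
    rw [AddChar.ne_one_iff]
    exact exists_chi_ne_one)
  rw [AddChar.sum_mulShift a hprim]
  split_ifs <;> simp

theorem trace_trace_zmod {E L : Type*} [Field E] [Field L] [Algebra E L] [Finite L]
    [Algebra (ZMod 2) E] [Algebra (ZMod 2) L] (x : L) :
    Algebra.trace (ZMod 2) E (Algebra.trace E L x) = Algebra.trace (ZMod 2) L x := by
  have : IsScalarTower (ZMod 2) E L := IsScalarTower.of_algebraMap_eq' (RingHom.ext_zmod _ _)
  have : Finite E := Finite.of_injective _ (algebraMap E L).injective
  exact Algebra.trace_trace x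

/-- For t in the subfield, transitivity gives Tr(t x) = Tr(t · Tr_e x); the absolute trace form of
the subfield is nondegenerate. -/
theorem trE_eq_zero_iff [Finite K] {e : ℕ} (x : K) :
    trE e x = 0 ↔ ∀ t ∈ subfieldTwoPow K e, chi K (t * x) = 1 := by
  let := ZMod.algebra K 2
  let := ZMod.algebra (subfieldTwoPow K e) 2
  have key : ∀ t : subfieldTwoPow K e, Algebra.trace (ZMod 2) K ((t : K) * x) =
      Algebra.trace (ZMod 2) (subfieldTwoPow K e) (t * trE e x) := by
    intro t
    have h1 := trace_trace_zmod (E := subfieldTwoPow K e) ((t : K) * x)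
    have h2 := (Algebra.trace (subfieldTwoPow K e) K).map_smul t x
    rw [← h1]
    exact congrArg _ h2
  constructor
  · intro h t ht
    rw [chi_eq_one_iff]
    have := key ⟨t, ht⟩
    rw [h, mul_zero, map_zero] at this
    exact this
  · intro h
    apply (traceForm_nondegenerate (ZMod 2) (subfieldTwoPow K e)).1
    intro t
    rw [Algebra.traceForm_apply, mul_comm, ← key, ← chi_eq_one_iff]
    exact h t t.2

/-- The condition `Tr_e x = 1`, phrased with the canonical additive character. -/
def TrOne (e : ℕ) (x : K) : Prop := ∀ t ∈ subfieldTwoPow K e, chi K (t * x) = chi K t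

/-- As n / e is odd, Tr_e 1 = 1, so the condition becomes Tr_e (x + 1) = 0. -/
theorem trOne_iff [Finite K] {n k e : ℕ} (h : GoldHyp K n k e) (x : K) :
    TrOne e x ↔ trE e x = 1 := by
  have h1 : trE e x = 1 ↔ trE e (x + 1) = 0 := by
    have : trE e (x + 1) = trE e x + trE e (1 : K) := map_add _ _ _
    rw [this, h.trE_one]
    exact CharTwo.add_eq_zero.symm
  rw [h1, trE_eq_zero_iff, TrOne]
  refine forall₂_congr fun t _ => ?_
  rw [mul_add, mul_one, chi_add]
  rcases chi_eq_one_or (t * x) with h1 | h1 <;> rcases chi_eq_one_or t with h2 | h2 <;>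
    rw [h1, h2] <;> norm_num

theorem not_trOne_zero [Finite K] {n k e : ℕ} (h : GoldHyp K n k e) : ¬ TrOne e (0 : K) := by
  rw [trOne_iff h]
  have : trE e (0 : K) = 0 := map_zero _
  rw [this]
  exact zero_ne_one

theorem TrOne.eq_one_of_mul [Finite K] {n k e : ℕ} (h : GoldHyp K n k e) {x z : K}
    (hx : TrOne e x) (hzx : TrOne e (z * x)) (hz : z ∈ subfieldTwoPow K e) : z = 1 := by
  rw [trOne_iff h] at hx hzx
  have : trE e (z * x) = (⟨z, hz⟩ : subfieldTwoPow K e) * trE e x :=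
    (Algebra.trace (subfieldTwoPow K e) K).map_smul ⟨z, hz⟩ x
  rw [hx, hzx, mul_one] at this
  exact congrArg Subtype.val this.symm

end Character

end CBoomerang

namespace CBoomerang

open Finset

/-! ### Evaluation of the Weil sums up to sign. -/

section WeilSum

variable {K : Type*} [Field K] [CharP K 2] [Fintype K] [DecidableEq K] {n k e : ℕ}

theorem GoldHyp.cast_card (h : GoldHyp K n k e) : (Fintype.card K : ℝ) = 2 ^ n := by
  rw [← Nat.card_eq_fintype_card, h.card]
  norm_num

theorem gold_add (x y : K) : (x + y) ^ (2 ^ k + 1) =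
    x ^ (2 ^ k + 1) + x ^ 2 ^ k * y + x * y ^ 2 ^ k + y ^ (2 ^ k + 1) := by
  rw [pow_succ, add_pow_two_pow]
  ring

theorem GoldHyp.chi_pow_mul (h : GoldHyp K n k e) (x y : K) :
    chi K (x ^ 2 ^ k * y) = chi K (x * y ^ 2 ^ (n - k)) := by
  rw [← chi_pow_two_pow (x * y ^ 2 ^ (n - k)) k, mul_pow, h.pow_sub_pow]

/-- The Weil sum of `x ^ (2 ^ k + 1) + w x`. -/
noncomputable def goldSum (k : ℕ) (w : K) : ℝ := ∑ x : K, chi K (x ^ (2 ^ k + 1) + w * x)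

theorem GoldHyp.pow_eq_pow_iff (h : GoldHyp K n k e) {x : K} :
    x ^ 2 ^ (n - k) + x ^ 2 ^ k = 0 ↔ x ∈ subfieldTwoPow K e := by
  refine ⟨fun hx => h.mem_of_pow_two_mul_k ?_,
    fun hx => by rw [h.pow_sub_of_mem hx, h.pow_k_of_mem hx, add_self]⟩
  rw [two_mul, pow_add, pow_mul, ← eq_of_add_eq_zero hx]
  exact h.pow_sub_pow x

open Classical in
theorem sum_subfield_chi (h : GoldHyp K n k e) (w : K) :
    ∑ t : K, (if t ∈ subfieldTwoPow K e then chi K (t * (1 + w)) else 0) =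
      if TrOne e w then (2 : ℝ) ^ e else 0 := by
  have hconv : ∑ t : K, (if t ∈ subfieldTwoPow K e then chi K (t * (1 + w)) else 0) =
      ∑ t : subfieldTwoPow K e, chi K ((t : K) * (1 + w)) := by
    rw [← Finset.sum_filter]
    exact Finset.sum_subtype _ (fun x => by simp) _
  rw [hconv]
  let ψ : AddChar (subfieldTwoPow K e) ℝ := (chi K).compAddMonoidHom
    ((AddMonoidHom.mulRight (1 + w)).comp (subfieldTwoPow K e).toSubring.subtype.toAddMonoidHom)
  have hψ : ∀ t, ψ t = chi K ((t : K) * (1 + w)) := fun _ => rfl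
  have hone : ψ = 1 ↔ TrOne e w := by
    rw [AddChar.eq_one_iff, TrOne, Subtype.forall]
    refine forall₂_congr fun t ht => ?_
    rw [hψ]
    simp only
    rw [mul_add, mul_one, chi_add]
    rcases chi_eq_one_or (t * w) with h1 | h1 <;> rcases chi_eq_one_or t with h2 | h2 <;>
      rw [h1, h2] <;> norm_num
  simp only [← hψ]
  split_ifs with hw
  · rw [AddChar.sum_eq_card_of_eq_one (hone.mpr hw), ← Nat.card_eq_fintype_card, h.card_subfield]
    norm_num
  · exact AddChar.sum_eq_zero_of_ne_one (fun h1 => hw (hone.mp h1))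

-- Put y = x + t in the double sum. The sum over x of χ(x(t^(2^(n-k)) + t^(2^k))) vanishes unless t
-- ∈ 𝔽_{2^e}; there t^(2^k+1) = t² and χ(t²) = χ(t), which leaves the subfield sum of χ(t(1 + w)).
open Classical in
theorem goldSum_sq (h : GoldHyp K n k e) (w : K) :
    goldSum k w ^ 2 = if TrOne e w then (2 : ℝ) ^ n * 2 ^ e else 0 := by
  have key : ∀ t x : K, chi K (x ^ (2 ^ k + 1) + w * x) *
      chi K ((x + t) ^ (2 ^ k + 1) + w * (x + t)) =
      chi K (t ^ (2 ^ k + 1) + w * t) * chi K (x * (t ^ 2 ^ (n - k) + t ^ 2 ^ k)) := by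
    intro t x
    have e1 : chi K (x * (t ^ 2 ^ (n - k) + t ^ 2 ^ k)) = chi K (x ^ 2 ^ k * t + x * t ^ 2 ^ k) := by
      rw [mul_add, chi_add, chi_add, h.chi_pow_mul]
    rw [e1, ← chi_add, ← chi_add, gold_add]
    congr 1
    linear_combination (x ^ (2 ^ k + 1) + w * x) * CharTwo.two_eq_zero (R := K)
  have hstep : goldSum k w ^ 2 = ∑ t : K, chi K (t ^ (2 ^ k + 1) + w * t) *
      ∑ x : K, chi K (x * (t ^ 2 ^ (n - k) + t ^ 2 ^ k)) := by
    rw [sq, goldSum, Finset.sum_mul_sum]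
    simp_rw [Finset.mul_sum, ← key]
    rw [Finset.sum_comm (s := univ (α := K)) (t := univ (α := K))
      (f := fun t x => chi K (x ^ (2 ^ k + 1) + w * x) *
        chi K ((x + t) ^ (2 ^ k + 1) + w * (x + t)))]
    refine Finset.sum_congr rfl fun x _ => ?_
    exact (Equiv.sum_comp (Equiv.addLeft x) fun y => chi K (x ^ (2 ^ k + 1) + w * x) *
      chi K (y ^ (2 ^ k + 1) + w * y)).symm
  have hterm : ∀ t : K, chi K (t ^ (2 ^ k + 1) + w * t) *
      ∑ x : K, chi K (x * (t ^ 2 ^ (n - k) + t ^ 2 ^ k)) =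
      2 ^ n * if t ∈ subfieldTwoPow K e then chi K (t * (1 + w)) else 0 := by
    intro t
    rw [sum_chi_mul, h.cast_card]
    simp only [h.pow_eq_pow_iff]
    split_ifs with ht
    · rw [pow_succ, h.pow_k_of_mem ht, ← sq, chi_add, chi_sq, mul_add, mul_one, chi_add,
        mul_comm w t]
      ring
    · simp
  rw [hstep, Finset.sum_congr rfl fun t _ => hterm t, ← Finset.mul_sum, sum_subfield_chi h]
  split_ifs <;> simp

theorem sum_chi_gold_add_mul (γ B : K) (hγ : γ ≠ 0) :
    ∑ x : K, chi K (γ ^ (2 ^ k + 1) * x ^ (2 ^ k + 1) + B * x) = goldSum k (B * γ⁻¹) := by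
  rw [goldSum, ← Equiv.sum_comp (Equiv.mulLeft₀ γ hγ)
    fun x => chi K (x ^ (2 ^ k + 1) + B * γ⁻¹ * x)]
  refine Finset.sum_congr rfl fun x _ => ?_
  congr 1
  simp only [Equiv.mulLeft₀_apply]
  rw [mul_pow]
  field_simp

/-- The exponential sum of `α F x + β F (x + 1)` for `F x = x ^ (2 ^ k + 1)`. -/
noncomputable def pairSum (k : ℕ) (α β : K) : ℝ :=
  ∑ x : K, chi K (α * x ^ (2 ^ k + 1) + β * (x + 1) ^ (2 ^ k + 1))

/-- Invariance of χ under Frobenius replaces β x^(2^k) by β^(2^(n-k)) x, so the two cross terms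
merge into B x. -/
theorem pairSum_eq (h : GoldHyp K n k e) (α β : K) :
    pairSum k α β = chi K β *
      ∑ x : K, chi K ((α + β) * x ^ (2 ^ k + 1) + (β ^ 2 ^ (n - k) + β) * x) := by
  rw [pairSum, Finset.mul_sum]
  refine Finset.sum_congr rfl fun x _ => ?_
  have e1 : chi K ((α + β) * x ^ (2 ^ k + 1) + (β ^ 2 ^ (n - k) + β) * x) =
      chi K ((α + β) * x ^ (2 ^ k + 1) + β * x + x ^ 2 ^ k * β) := by
    rw [chi_add _ (x ^ 2 ^ k * β), h.chi_pow_mul, ← chi_add]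
    congr 1
    ring
  rw [e1, ← chi_add, gold_add]
  congr 1
  simp only [one_pow, mul_one]
  ring

theorem pairSum_comm (α β : K) : pairSum k α β = pairSum k β α := by
  rw [pairSum, pairSum, ← Equiv.sum_comp (Equiv.addRight (1 : K))]
  refine Finset.sum_congr rfl fun x _ => ?_
  congr 1
  simp only [Equiv.coe_addRight]
  rw [add_assoc, add_self, add_zero, add_comm]

open Classical in
theorem abs_pairSum_of_add_eq_zero (h : GoldHyp K n k e) {α β : K} (hA : α + β = 0) :
    |pairSum k α β| = if β ∈ subfieldTwoPow K e then (2 : ℝ) ^ n else 0 := by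
  rw [pairSum_eq h, hA]
  have e1 : ∑ x : K, chi K (0 * x ^ (2 ^ k + 1) + (β ^ 2 ^ (n - k) + β) * x) =
      ∑ x : K, chi K (x * (β ^ 2 ^ (n - k) + β)) :=
    Finset.sum_congr rfl fun x _ => by rw [zero_mul, zero_add, mul_comm]
  rw [e1, sum_chi_mul, h.cast_card]
  simp only [h.pow_sub_add_self_eq_zero]
  rcases chi_eq_one_or β with h1 | h1 <;> rw [h1] <;> split_ifs <;> simp

theorem pairSum_of_root (h : GoldHyp K n k e) {α β γ : K} (hγ : γ ^ (2 ^ k + 1) = α + β)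
    (hγ0 : γ ≠ 0) : pairSum k α β = chi K β * goldSum k ((β ^ 2 ^ (n - k) + β) * γ⁻¹) := by
  rw [pairSum_eq h, ← hγ, sum_chi_gold_add_mul _ _ hγ0]

theorem root_ne_zero {A γ : K} (hA : A ≠ 0) (hγ : γ ^ (2 ^ k + 1) = A) : γ ≠ 0 := by
  rintro rfl
  rw [zero_pow (by positivity)] at hγ
  exact hA hγ.symm

/-- The clause B ≠ 0 is automatic, because Tr_e 0 ≠ 1, and the root γ is unique. -/
theorem traceCond_iff (h : GoldHyp K n k e) {A B γ : K} (hγ : γ ^ (2 ^ k + 1) = A) :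
    TraceCond k e A B ↔ A ≠ 0 ∧ TrOne e (B * γ⁻¹) := by
  constructor
  · rintro ⟨hA, -, γ', hγ', ht⟩
    have : γ' = γ := h.gold_injective (hγ'.trans hγ.symm)
    rw [this] at ht
    exact ⟨hA, (trOne_iff h _).mpr ht⟩
  · rintro ⟨hA, ht⟩
    refine ⟨hA, ?_, γ, hγ, (trOne_iff h _).mp ht⟩
    rintro rfl
    rw [zero_mul] at ht
    exact not_trOne_zero h ht

open Classical in
theorem pairSum_sq (h : GoldHyp K n k e) {α β : K} (hA : α + β ≠ 0) :
    pairSum k α β ^ 2 =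
      if TraceCond k e (α + β) (β ^ 2 ^ (n - k) + β) then (2 : ℝ) ^ n * 2 ^ e else 0 := by
  obtain ⟨γ, hγ⟩ := h.exists_root (α + β)
  rw [pairSum_of_root h hγ (root_ne_zero hA hγ), mul_pow, goldSum_sq h, sq, chi_mul_self, one_mul]
  simp only [traceCond_iff h hγ, ne_eq, hA, not_false_eq_true, true_and]

end WeilSum

end CBoomerang

namespace CBoomerang

open Finset

/-! ### Fourier expansion of the table entries. -/

section Count

variable {K : Type*} [Field K] [CharP K 2] [Fintype K] [DecidableEq K] {n k e : ℕ}

theorem cBCT_scale (c a b : K) (ha : a ≠ 0) :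
    cBCT (fun x : K => x ^ (2 ^ k + 1)) c a b =
      cBCT (fun x : K => x ^ (2 ^ k + 1)) c 1 (b / a ^ (2 ^ k + 1)) := by
  have ha' : a ^ (2 ^ k + 1) ≠ 0 := pow_ne_zero _ ha
  have hs : ∀ u v : K, (a * u) ^ (2 ^ k + 1) - v * (a * u) ^ (2 ^ k + 1) =
    a ^ (2 ^ k + 1) * (u ^ (2 ^ k + 1) - v * u ^ (2 ^ k + 1)) := fun u v => by
      rw [mul_pow]; ring
  unfold cBCT
  symm
  refine Set.ncard_congr (fun p _ => (a * p.1, a * p.2)) ?_ ?_ ?_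
  · rintro ⟨x, y⟩ ⟨h1, h2⟩
    simp only at h1 h2
    rw [eq_div_iff ha'] at h1 h2
    refine ⟨?_, ?_⟩
    · rw [← h1]
      simp only [mul_pow]
      ring
    · rw [← h2]
      have e1 : a * x + a = a * (x + 1) := by ring
      have e2 : a * y + a = a * (y + 1) := by ring
      simp only [e1, e2, mul_pow]
      ring
  · rintro ⟨x, y⟩ ⟨x', y'⟩ - - hxy
    simp only [Prod.mk.injEq] at hxy
    exact Prod.ext (mul_left_cancel₀ ha hxy.1) (mul_left_cancel₀ ha hxy.2)
  · rintro ⟨x, y⟩ ⟨h1, h2⟩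
    refine ⟨(x / a, y / a), ⟨?_, ?_⟩, ?_⟩
    · simp only [div_pow]
      rw [← h1]
      ring
    · have e1 : x / a + 1 = (x + a) / a := by field_simp
      have e2 : y / a + 1 = (y + a) / a := by field_simp
      simp only [e1, e2, div_pow]
      rw [← h2]
      ring
    · simp only [mul_div_cancel₀ _ ha]

/-- The contribution of the pair of frequencies `p` to the entry at `(1, b)`. -/
noncomputable def entryTerm (k : ℕ) (c b : K) (p : K × K) : ℝ :=
  chi K (b * (p.1 + p.2)) * (pairSum k p.1 p.2 * pairSum k (c * p.1) (c⁻¹ * p.2))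

theorem sub_eq_iff_add_eq_zero (u v b : K) : u - v = b ↔ u + v + b = 0 := by
  rw [CharTwo.sub_eq_add]
  exact ⟨fun h => by rw [h, add_self], fun h => eq_of_add_eq_zero h⟩

/-- Each of the two equations is detected by a full character sum, with frequencies α and β. The
sums over x and y then separate: x yields S(α, β) and y yields S(cα, c⁻¹β). -/
theorem cBCT_mul_sq (h : GoldHyp K n k e) (c b : K) :
    (cBCT (fun x : K => x ^ (2 ^ k + 1)) c 1 b : ℝ) * (2 ^ n) ^ 2 =
      ∑ p : K × K, entryTerm k c b p := by
  set E1 : K × K → K := fun z => z.1 ^ (2 ^ k + 1) + c * z.2 ^ (2 ^ k + 1) + b with hE1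
  set E2 : K × K → K := fun z =>
    (z.1 + 1) ^ (2 ^ k + 1) + c⁻¹ * (z.2 + 1) ^ (2 ^ k + 1) + b with hE2
  have hterm : ∀ p : K × K, entryTerm k c b p =
      ∑ z : K × K, chi K (p.1 * E1 z) * chi K (p.2 * E2 z) := by
    intro p
    rw [entryTerm, pairSum, pairSum, Finset.sum_mul_sum, Fintype.sum_prod_type, Finset.mul_sum]
    refine Finset.sum_congr rfl fun x _ => ?_
    rw [Finset.mul_sum]
    refine Finset.sum_congr rfl fun y _ => ?_
    rw [← chi_add, ← chi_add, ← chi_add]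
    congr 1
    simp only [hE1, hE2]
    ring
  have hcount : (cBCT (fun x : K => x ^ (2 ^ k + 1)) c 1 b : ℝ) =
      ∑ z : K × K, if E1 z = 0 ∧ E2 z = 0 then (1 : ℝ) else 0 := by
    rw [Finset.sum_boole, cBCT, ← Set.ncard_coe_finset]
    congr 2
    ext z
    simp only [Finset.coe_filter, Finset.mem_univ, true_and, Set.mem_ofPred_eq, hE1, hE2,
      sub_eq_iff_add_eq_zero]
  rw [hcount, Finset.sum_mul]
  simp_rw [hterm]
  rw [Finset.sum_comm]
  refine Finset.sum_congr rfl fun z _ => ?_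
  rw [Fintype.sum_prod_type]
  simp only
  rw [← Finset.sum_mul_sum, sum_chi_mul, sum_chi_mul, h.cast_card]
  by_cases h1 : E1 z = 0 <;> by_cases h2 : E2 z = 0 <;> simp [h1, h2]
  ring

end Count

/-! ### Sizes and support of the Fourier terms. -/

section Support

variable {K : Type*} [Field K] [CharP K 2] [Fintype K] [DecidableEq K] {n k e : ℕ}

/-- The pairs of frequencies for which exactly one of the two exponential sums degenerates. -/
def mixedSet (K : Type*) [Field K] [CharP K 2] (n k e : ℕ) (c : K) : Set (K × K) :=
  (setA K e ∩ setF' n k e c) ∪ (setA' e c ∩ setF K n k e)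

/-- The pairs of frequencies for which both exponential sums are nondegenerate. -/
def genericSet (K : Type*) [Field K] [CharP K 2] (n k e : ℕ) (c : K) : Set (K × K) :=
  setF K n k e ∩ setF' n k e c

theorem ne_zero_of_notMem {c : K} (hc : c ∉ subfieldTwoPow K e) : c ≠ 0 := by
  rintro rfl
  exact hc (zero_mem _)

theorem add_one_ne_zero_of_notMem {c : K} (hc : c ∉ subfieldTwoPow K e) : c + 1 ≠ 0 := by
  intro h0
  rw [eq_of_add_eq_zero h0] at hc
  exact hc (one_mem _)

theorem add_inv_ne_zero_of_notMem {c : K} (hc : c ∉ subfieldTwoPow K e) : c + c⁻¹ ≠ 0 := by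
  have h0 := ne_zero_of_notMem hc
  have h1 := add_one_ne_zero_of_notMem hc
  intro h2
  have h3 : (c + 1) ^ 2 = 0 := by
    rw [CharTwo.add_sq, one_pow]
    have := congrArg (· * c) h2
    simp only [add_mul, inv_mul_cancel₀ h0, zero_mul] at this
    rw [sq, this]
  exact h1 (pow_eq_zero_iff two_ne_zero |>.mp h3)

theorem sq_twist_eq {N : ℕ} (hN : 2 * N = n + e) : ((2 : ℝ) ^ N) ^ 2 = 2 ^ n * 2 ^ e := by
  rw [← pow_mul, ← pow_add, mul_comm, hN]

theorem abs_pairSum_of_traceCond (h : GoldHyp K n k e) {N : ℕ} (hN : 2 * N = n + e) {α β : K}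
    (hT : TraceCond k e (α + β) (β ^ 2 ^ (n - k) + β)) : |pairSum k α β| = 2 ^ N := by
  have := pairSum_sq h hT.1
  rwa [if_pos hT, ← sq_twist_eq hN, sq_eq_sq_iff_abs_eq_abs,
    abs_of_pos (show (0 : ℝ) < 2 ^ N by positivity)] at this

theorem abs_entryTerm_le_of_mem_mixedSet (h : GoldHyp K n k e) {N : ℕ} (hN : 2 * N = n + e)
    (c b : K) {p : K × K} (hp : p ∈ mixedSet K n k e c) :
    |entryTerm k c b p| ≤ 2 ^ n * 2 ^ N := by
  have hchi : |chi K (b * (p.1 + p.2))| = 1 := by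
    rcases chi_eq_one_or (b * (p.1 + p.2)) with h1 | h1 <;> rw [h1] <;> norm_num
  rw [entryTerm, abs_mul, hchi, one_mul, abs_mul]
  rcases hp with ⟨hA, hF⟩ | ⟨hA, hF⟩
  · have h0 : p.1 + p.2 = 0 := by rw [hA.1, add_self]
    rw [abs_pairSum_of_add_eq_zero h h0, if_pos hA.2, abs_pairSum_of_traceCond h hN hF]
  · have h0 : c * p.1 + c⁻¹ * p.2 = 0 := by rw [hA.1, add_self]
    rw [abs_pairSum_of_add_eq_zero h h0, if_pos hA.2, abs_pairSum_of_traceCond h hN hF, mul_comm]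

theorem abs_entryTerm_of_mem_genericSet (h : GoldHyp K n k e)
    {N : ℕ} (hN : 2 * N = n + e) (c b : K) {p : K × K} (hp : p ∈ genericSet K n k e c) :
    |entryTerm k c b p| = 2 ^ n * 2 ^ e := by
  have hchi : |chi K (b * (p.1 + p.2))| = 1 := by
    rcases chi_eq_one_or (b * (p.1 + p.2)) with h1 | h1 <;> rw [h1] <;> norm_num
  rw [entryTerm, abs_mul, hchi, one_mul, abs_mul, abs_pairSum_of_traceCond h hN hp.1,
    abs_pairSum_of_traceCond h hN hp.2, ← sq_twist_eq hN, sq]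

theorem entryTerm_eq_zero (h : GoldHyp K n k e) {c : K} (hc : c ∉ subfieldTwoPow K e) (b : K)
    {p : K × K} (hp0 : p ≠ 0) (hp1 : p ∉ mixedSet K n k e c) (hp2 : p ∉ genericSet K n k e c) :
    entryTerm k c b p = 0 := by
  obtain ⟨α, β⟩ := p
  rw [entryTerm]
  simp only
  have z1 : ∀ α β : K, α + β = 0 → β ∉ subfieldTwoPow K e → pairSum k α β = 0 :=
    fun α β h0 h1 => by
      rw [← abs_eq_zero, abs_pairSum_of_add_eq_zero h h0, if_neg h1]
  have z2 : ∀ α β : K, α + β ≠ 0 → ¬ TraceCond k e (α + β) (β ^ 2 ^ (n - k) + β) →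
      pairSum k α β = 0 := fun α β h0 h1 => by
    have := pairSum_sq h h0
    rw [if_neg h1] at this
    exact pow_eq_zero_iff two_ne_zero |>.mp this
  by_contra hne
  have hne1 : pairSum k α β ≠ 0 := fun h0 => hne (by rw [h0]; ring)
  have hne2 : pairSum k (c * α) (c⁻¹ * β) ≠ 0 := fun h0 => hne (by rw [h0]; ring)
  have hF : α + β ≠ 0 → (α, β) ∈ setF K n k e := fun h0 => by
    by_contra h1
    exact hne1 (z2 _ _ h0 h1)
  have hF' : c * α + c⁻¹ * β ≠ 0 → (α, β) ∈ setF' n k e c := fun h0 => by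
    by_contra h1
    exact hne2 (z2 _ _ h0 h1)
  have hA : α + β = 0 → (α, β) ∈ setA K e := fun h0 => by
    refine ⟨eq_of_add_eq_zero h0, ?_⟩
    by_contra h1
    exact hne1 (z1 _ _ h0 h1)
  have hA' : c * α + c⁻¹ * β = 0 → (α, β) ∈ setA' e c := fun h0 => by
    refine ⟨eq_of_add_eq_zero h0, ?_⟩
    by_contra h1
    exact hne2 (z1 _ _ h0 h1)
  by_cases h1 : α + β = 0 <;> by_cases h2 : c * α + c⁻¹ * β = 0
  -- Both sums degenerate only at the origin: α = β and (c + c⁻¹)α = 0, where c + c⁻¹ ≠ 0.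
  · have h3 : α = β := eq_of_add_eq_zero h1
    subst h3
    rw [← add_mul] at h2
    rcases mul_eq_zero.mp h2 with h4 | h4
    · exact add_inv_ne_zero_of_notMem hc h4
    · exact hp0 (by rw [h4]; rfl)
  · exact hp1 (Or.inl ⟨hA h1, hF' h2⟩)
  · exact hp1 (Or.inr ⟨hA' h2, hF h1⟩)
  · exact hp2 ⟨hF h1, hF' h2⟩

theorem entryTerm_zero (h : GoldHyp K n k e) (c b : K) : entryTerm k c b 0 = (2 ^ n) ^ 2 := by
  have : pairSum k (0 : K) 0 = 2 ^ n := by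
    rw [pairSum]
    simp only [zero_mul, add_zero, chi_zero, Finset.sum_const, Finset.card_univ, nsmul_eq_mul,
      mul_one]
    exact h.cast_card
  simp only [entryTerm, Prod.fst_zero, Prod.snd_zero, mul_zero, add_zero, chi_zero, one_mul, this,
    sq]

theorem zero_notMem_mixedSet (c : K) : (0 : K × K) ∉ mixedSet K n k e c := by
  rintro (⟨-, h, -⟩ | ⟨-, h, -⟩) <;> simp at h

theorem zero_notMem_genericSet (c : K) : (0 : K × K) ∉ genericSet K n k e c := by
  rintro ⟨⟨h, -⟩, -⟩
  simp at h

theorem disjoint_mixedSet_genericSet (c : K) {p : K × K} (hp : p ∈ mixedSet K n k e c) :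
    p ∉ genericSet K n k e c := by
  rintro ⟨h1, h2⟩
  rcases hp with ⟨hA, -⟩ | ⟨hA, -⟩
  · exact h1.1 (by rw [hA.1, add_self])
  · exact h2.1 (by rw [hA.1, add_self])

open Classical in
theorem cBCT_mul_sq_eq (h : GoldHyp K n k e) {c : K} (hc : c ∉ subfieldTwoPow K e) (b : K) :
    (cBCT (fun x : K => x ^ (2 ^ k + 1)) c 1 b : ℝ) * (2 ^ n) ^ 2 = (2 ^ n) ^ 2 +
      ∑ p with p ∈ mixedSet K n k e c, entryTerm k c b p +
      ∑ p with p ∈ genericSet K n k e c, entryTerm k c b p := by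
  rw [cBCT_mul_sq h]
  have hsplit : ∀ p : K × K, entryTerm k c b p =
      (if p = 0 then entryTerm k c b p else 0) +
      (if p ∈ mixedSet K n k e c then entryTerm k c b p else 0) +
      (if p ∈ genericSet K n k e c then entryTerm k c b p else 0) := by
    intro p
    by_cases h0 : p = 0
    · rw [if_pos h0, h0, if_neg (zero_notMem_mixedSet c), if_neg (zero_notMem_genericSet c),
        add_zero, add_zero]
    · rw [if_neg h0]
      by_cases h1 : p ∈ mixedSet K n k e c
      · rw [if_pos h1, if_neg (disjoint_mixedSet_genericSet c h1)]
        ring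
      · rw [if_neg h1]
        by_cases h2 : p ∈ genericSet K n k e c
        · rw [if_pos h2]
          ring
        · rw [if_neg h2, entryTerm_eq_zero h hc b h0 h1 h2]
          ring
  rw [Finset.sum_congr rfl fun p _ => hsplit p, Finset.sum_add_distrib, Finset.sum_add_distrib,
    Finset.sum_ite_eq' univ (0 : K × K), if_pos (mem_univ _), entryTerm_zero h, Finset.sum_filter,
    Finset.sum_filter]

open Classical in
/-- The estimate by absolute values, improved by a set `s` of frequencies with a negative
contribution. -/
theorem cBCT_mul_sq_le (h : GoldHyp K n k e) {N : ℕ} (hN : 2 * N = n + e) {c : K}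
    (hc : c ∉ subfieldTwoPow K e) (b : K) (s : Finset (K × K))
    (hs : ∀ p ∈ s, p ∈ genericSet K n k e c ∧ entryTerm k c b p ≤ 0) :
    (cBCT (fun x : K => x ^ (2 ^ k + 1)) c 1 b : ℝ) * (2 ^ n) ^ 2 ≤ (2 ^ n) ^ 2 +
      (mixedSet K n k e c).ncard * (2 ^ n * 2 ^ N) +
      ((genericSet K n k e c).ncard - 2 * (s.card : ℝ)) * (2 ^ n * 2 ^ e) := by
  rw [cBCT_mul_sq_eq h hc]
  have h1 : ∑ p with p ∈ mixedSet K n k e c, entryTerm k c b p ≤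
      (mixedSet K n k e c).ncard * (2 ^ n * 2 ^ N) := by
    have : (mixedSet K n k e c).ncard = #{p | p ∈ mixedSet K n k e c} := by
      rw [← Set.ncard_coe_finset]
      congr 1
      ext p
      simp
    rw [this, ← nsmul_eq_mul]
    exact Finset.sum_le_card_nsmul _ _ _ fun p hp => (le_abs_self _).trans
      (abs_entryTerm_le_of_mem_mixedSet h hN c b (Finset.mem_filter.mp hp).2)
  have h2 : ∑ p with p ∈ genericSet K n k e c, entryTerm k c b p ≤
      ((genericSet K n k e c).ncard - 2 * (s.card : ℝ)) * (2 ^ n * 2 ^ e) := by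
    have hcard : (genericSet K n k e c).ncard = #{p | p ∈ genericSet K n k e c} := by
      rw [← Set.ncard_coe_finset]
      congr 1
      ext p
      simp
    have hsub : s ⊆ ({p | p ∈ genericSet K n k e c} : Finset (K × K)) := fun p hp => by
      rw [Finset.mem_filter]
      exact ⟨mem_univ _, (hs p hp).1⟩
    rw [hcard, ← Finset.sum_sdiff hsub]
    have h3 : ∑ p ∈ ({p | p ∈ genericSet K n k e c} : Finset (K × K)) \ s, entryTerm k c b p ≤
        (#{p | p ∈ genericSet K n k e c} - s.card : ℝ) * (2 ^ n * 2 ^ e) := by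
      rw [← Nat.cast_sub (Finset.card_le_card hsub), ← Finset.card_sdiff_of_subset hsub,
        ← nsmul_eq_mul]
      exact Finset.sum_le_card_nsmul _ _ _ fun p hp => (le_abs_self _).trans
        (abs_entryTerm_of_mem_genericSet h hN c b
          (Finset.mem_filter.mp (Finset.mem_sdiff.mp hp).1).2).le
    -- Each frequency in `s` contributes minus the generic size instead of plus, whence the factor 2
    -- in front of its cardinality.
    have h4 : ∑ p ∈ s, entryTerm k c b p = -(s.card * (2 ^ n * 2 ^ e)) := by
      rw [Finset.sum_congr rfl fun p hp => show entryTerm k c b p = -(2 ^ n * 2 ^ e) by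
        rw [← abs_entryTerm_of_mem_genericSet h hN c b (hs p hp).1,
          abs_of_nonpos (hs p hp).2, neg_neg]]
      simp
    rw [h4]
    linarith
  linarith

end Support

end CBoomerang

namespace CBoomerang

open Finset

/-! ### At most two mixed frequencies. -/

section MixedSet

variable {K : Type*} [Field K] [CharP K 2] [Fintype K] [DecidableEq K] {n k e : ℕ}

/-- Multiplying (A, B) by z² with z ∈ 𝔽_{2^e} multiplies γ by z, hence B γ⁻¹ and its relative trace
by z. The trace can equal 1 for one z only. -/
theorem traceCond_mul_unique (h : GoldHyp K n k e) {D κ t₁ t₂ : K}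
    (ht₁ : t₁ ∈ subfieldTwoPow K e) (ht₂ : t₂ ∈ subfieldTwoPow K e)
    (h₁ : TraceCond k e (t₁ * D) (t₁ * κ)) (h₂ : TraceCond k e (t₂ * D) (t₂ * κ)) : t₁ = t₂ := by
  have h20 : t₂ ≠ 0 := left_ne_zero_of_mul h₂.1
  obtain ⟨γ₁, hγ₁⟩ := h.exists_root (t₁ * D)
  obtain ⟨γ₂, hγ₂⟩ := h.exists_root (t₂ * D)
  have hγ20 := root_ne_zero h₂.1 hγ₂
  have hγ10 := root_ne_zero h₁.1 hγ₁
  have hT₁ := ((traceCond_iff h hγ₁).mp h₁).2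
  have hT₂ := ((traceCond_iff h hγ₂).mp h₂).2
  have hdiv : t₁ / t₂ ∈ subfieldTwoPow K e := div_mem ht₁ ht₂
  -- The power 2^(e-1) extracts the square root inside 𝔽_{2^e}.
  set z := (t₁ / t₂) ^ 2 ^ (e - 1) with hzdef
  have hz : z ∈ subfieldTwoPow K e := pow_mem hdiv _
  have hz2 : z ^ 2 = t₁ / t₂ := by
    rw [hzdef, ← pow_mul, ← pow_succ, Nat.sub_add_cancel h.pos]
    exact hdiv
  have ht : t₁ = z ^ 2 * t₂ := by rw [hz2, div_mul_cancel₀ _ h20]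
  have hγ : γ₁ = z * γ₂ := h.gold_injective (by
    simp only
    rw [mul_pow, hγ₁, hγ₂, pow_succ z, h.pow_k_of_mem hz, ht]
    ring)
  have hz0 : z ≠ 0 := by
    rintro h0
    exact hγ10 (by rw [hγ, h0, zero_mul])
  have hT : t₁ * κ * γ₁⁻¹ = z * (t₂ * κ * γ₂⁻¹) := by
    rw [hγ, ht]
    field_simp
  rw [hT] at hT₁
  rw [ht, hT₂.eq_one_of_mul h hT₁ hz, one_pow, one_mul]

theorem setA_inter_setF'_subsingleton (h : GoldHyp K n k e) (c : K) :
    (setA K e ∩ setF' n k e c).Subsingleton := by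
  have key : ∀ t ∈ subfieldTwoPow K e, (t, t) ∈ setF' n k e c →
      TraceCond k e (t * (c + c⁻¹)) (t * (c⁻¹ ^ 2 ^ (n - k) + c⁻¹)) := by
    intro t ht hF
    have hF : TraceCond k e (c * t + c⁻¹ * t) ((c⁻¹ * t) ^ 2 ^ (n - k) + c⁻¹ * t) := hF
    have e1 : c * t + c⁻¹ * t = t * (c + c⁻¹) := by ring
    have e2 : (c⁻¹ * t) ^ 2 ^ (n - k) + c⁻¹ * t = t * (c⁻¹ ^ 2 ^ (n - k) + c⁻¹) := by
      rw [mul_pow, h.pow_sub_of_mem ht]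
      ring
    rwa [e1, e2] at hF
  rintro ⟨t₁, s₁⟩ ⟨⟨h1, h2⟩, h3⟩ ⟨t₂, s₂⟩ ⟨⟨h4, h5⟩, h6⟩
  simp only at h1 h2 h4 h5
  subst h1 h4
  rw [traceCond_mul_unique h h2 h5 (key _ h2 h3) (key _ h5 h6)]

theorem setA'_inter_setF_subsingleton (h : GoldHyp K n k e) {c : K} (hc : c ≠ 0) :
    (setA' e c ∩ setF K n k e).Subsingleton := by
  have key : ∀ t ∈ subfieldTwoPow K e, (c⁻¹ * t, c * t) ∈ setF K n k e →
      TraceCond k e (t * (c + c⁻¹)) (t * (c ^ 2 ^ (n - k) + c)) := by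
    intro t ht hF
    have hF : TraceCond k e (c⁻¹ * t + c * t) ((c * t) ^ 2 ^ (n - k) + c * t) := hF
    have e1 : c⁻¹ * t + c * t = t * (c + c⁻¹) := by ring
    have e2 : (c * t) ^ 2 ^ (n - k) + c * t = t * (c ^ 2 ^ (n - k) + c) := by
      rw [mul_pow, h.pow_sub_of_mem ht]
      ring
    rwa [e1, e2] at hF
  have param : ∀ p ∈ setA' e c ∩ setF K n k e, ∃ t ∈ subfieldTwoPow K e,
      p = (c⁻¹ * t, c * t) := by
    rintro ⟨α, β⟩ ⟨⟨h1, h2⟩, -⟩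
    simp only at h1 h2
    refine ⟨c⁻¹ * β, h2, Prod.ext ?_ ?_⟩
    · rw [← h1]
      field_simp
    · simp only
      field_simp
  intro p hp p' hp'
  obtain ⟨t, ht, rfl⟩ := param p hp
  obtain ⟨t', ht', rfl⟩ := param p' hp'
  rw [traceCond_mul_unique h ht ht' (key _ ht hp.2) (key _ ht' hp'.2)]

theorem ncard_mixedSet_le (h : GoldHyp K n k e) {c : K} (hc : c ≠ 0) :
    (mixedSet K n k e c).ncard ≤ 2 := by
  refine (Set.ncard_union_le _ _).trans ?_
  exact Nat.add_le_add
    (Set.ncard_le_one_iff_subsingleton.mpr (setA_inter_setF'_subsingleton h c))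
    (Set.ncard_le_one_iff_subsingleton.mpr (setA'_inter_setF_subsingleton h hc))

end MixedSet

/-! ### Negative generic terms on the line β = cα. -/

section Slice

variable {K : Type*} [Field K] [CharP K 2] [Fintype K] [DecidableEq K] {n k e : ℕ}

/-- Along `β = ρ u ^ (2 ^ k + 1)` the trace condition for `A = u ^ (2 ^ k + 1)` is affine
in `u`. -/
theorem traceCond_slice_iff (h : GoldHyp K n k e) (ρ u : K) :
    TraceCond k e (u ^ (2 ^ k + 1))
      ((ρ * u ^ (2 ^ k + 1)) ^ 2 ^ (n - k) + ρ * u ^ (2 ^ k + 1)) ↔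
      TrOne e ((ρ ^ 2 ^ (n - k) + ρ) * u) := by
  rw [traceCond_iff h rfl]
  by_cases hu : u = 0
  · subst hu
    simp [not_trOne_zero h]
  have hw : ((ρ * u ^ (2 ^ k + 1)) ^ 2 ^ (n - k) + ρ * u ^ (2 ^ k + 1)) * u⁻¹ =
      ρ ^ 2 ^ (n - k) * u ^ 2 ^ (n - k) + u ^ 2 ^ k * ρ := by
    have e1 : (u ^ (2 ^ k + 1)) ^ 2 ^ (n - k) = u * u ^ 2 ^ (n - k) := by
      rw [pow_succ, mul_pow, h.pow_pow_sub]
    rw [mul_pow, e1]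
    field_simp
    ring
  rw [hw]
  refine ⟨fun hT => ?_, fun hT => ⟨pow_ne_zero _ hu, ?_⟩⟩
  -- For t ∈ 𝔽_{2^e}, χ(t · ) is unchanged by Frobenius powers fixing t, so the two summands may be
  -- replaced by ρ u and ρ^(2^(n-k)) u.
  all_goals
    have hconv : ∀ t ∈ subfieldTwoPow K e,
        chi K (t * (ρ ^ 2 ^ (n - k) * u ^ 2 ^ (n - k) + u ^ 2 ^ k * ρ)) =
          chi K (t * ((ρ ^ 2 ^ (n - k) + ρ) * u)) := by
      intro t ht
      have e1 : chi K (t * (ρ ^ 2 ^ (n - k) * u ^ 2 ^ (n - k))) = chi K (t * (ρ * u)) := by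
        rw [← chi_pow_two_pow (t * (ρ * u)) (n - k), mul_pow, mul_pow, h.pow_sub_of_mem ht]
      have e2 : chi K (t * (u ^ 2 ^ k * ρ)) = chi K (t * (ρ ^ 2 ^ (n - k) * u)) := by
        rw [mul_left_comm, h.chi_pow_mul, mul_pow, h.pow_sub_of_mem ht]
        congr 1
        ring
      rw [mul_add, chi_add, e1, e2, ← chi_add]
      congr 1
      ring
    intro t ht
  · rw [← hconv t ht]
    exact hT.2 t ht
  · rw [hconv t ht]
    exact hT t ht

-- The trace condition is detected by summing χ(t(1 + κu)) over t in the subfield.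
open Classical in
theorem two_pow_mul_sum_trOne (h : GoldHyp K n k e) (κ : K) (g : K → ℝ) :
    2 ^ e * ∑ u : K, (if TrOne e (κ * u) then g u else 0) =
      ∑ t : K, if t ∈ subfieldTwoPow K e then
        chi K t * ∑ u : K, g u * chi K (u * (t * κ)) else 0 := by
  have hterm : ∀ u : K, 2 ^ e * (if TrOne e (κ * u) then g u else 0) =
      ∑ t : K, if t ∈ subfieldTwoPow K e then chi K t * (g u * chi K (u * (t * κ))) else 0 := by
    intro u
    have h1 : (2 : ℝ) ^ e * (if TrOne e (κ * u) then g u else 0) =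
        (if TrOne e (κ * u) then (2 : ℝ) ^ e else 0) * g u := by
      split_ifs <;> ring
    rw [h1, ← sum_subfield_chi h, Finset.sum_mul]
    refine Finset.sum_congr rfl fun t _ => ?_
    split_ifs
    · rw [mul_add, mul_one, chi_add, show t * (κ * u) = u * (t * κ) by ring]
      ring
    · rw [zero_mul]
  rw [Finset.mul_sum, Finset.sum_congr rfl fun u _ => hterm u, Finset.sum_comm]
  refine Finset.sum_congr rfl fun t _ => ?_
  split_ifs
  · rw [Finset.mul_sum]
  · simp

open Classical in
theorem two_pow_mul_card_trOne (h : GoldHyp K n k e) {κ : K} (hκ : κ ≠ 0) :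
    2 ^ e * ∑ u : K, (if TrOne e (κ * u) then (1 : ℝ) else 0) = 2 ^ n := by
  rw [two_pow_mul_sum_trOne h]
  have hterm : ∀ t : K, (if t ∈ subfieldTwoPow K e then
      chi K t * ∑ u : K, 1 * chi K (u * (t * κ)) else 0) = if t = 0 then (2 : ℝ) ^ n else 0 := by
    intro t
    simp only [one_mul]
    rw [sum_chi_mul, h.cast_card]
    by_cases ht : t = 0
    · rw [ht]
      simp [zero_mem]
    · simp [ht, hκ]
  rw [Finset.sum_congr rfl fun t _ => hterm t, Finset.sum_ite_eq' univ (0 : K),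
    if_pos (mem_univ _)]

theorem abs_goldSum (h : GoldHyp K n k e) {N : ℕ} (hN : 2 * N = n + e) {w : K} :
    |goldSum k w| ≤ 2 ^ N := by
  classical
  have := goldSum_sq h w
  split_ifs at this with hT
  · rw [← sq_twist_eq hN, sq_eq_sq_iff_abs_eq_abs, abs_of_pos (show (0 : ℝ) < 2 ^ N by positivity)]
      at this
    exact this.le
  · rw [pow_eq_zero_iff two_ne_zero |>.mp this, abs_zero]
    positivity

theorem goldSum_eq_zero (h : GoldHyp K n k e) {w : K} (hw : ¬ TrOne e w) : goldSum k w = 0 := by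
  classical
  have := goldSum_sq h w
  rw [if_neg hw] at this
  exact pow_eq_zero_iff two_ne_zero |>.mp this

-- Detecting the condition leaves Gold sums with parameters t κ g⁻¹, t ∈ 𝔽_{2^e}. By linearity of
-- the relative trace at most one of them is nonzero, and it is at most 2^N in absolute value.
open Classical in
theorem two_pow_mul_sum_trOne_chi_le (h : GoldHyp K n k e) {N : ℕ} (hN : 2 * N = n + e)
    (κ : K) {b : K} (hb : b ≠ 0) :
    2 ^ e * ∑ u : K, (if TrOne e (κ * u) then chi K (b * u ^ (2 ^ k + 1)) else 0) ≤ 2 ^ N := by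
  rw [two_pow_mul_sum_trOne h]
  obtain ⟨g, hg⟩ := h.exists_root b
  have hg0 := root_ne_zero hb hg
  have hterm : ∀ t : K, ∑ u : K, chi K (b * u ^ (2 ^ k + 1)) * chi K (u * (t * κ)) =
      goldSum k (t * κ * g⁻¹) := by
    intro t
    rw [← sum_chi_gold_add_mul g (t * κ) hg0, hg]
    refine Finset.sum_congr rfl fun u _ => ?_
    rw [← chi_add, mul_comm u]
  simp only [hterm]
  by_cases hex : ∃ t₀ ∈ subfieldTwoPow K e, TrOne e (t₀ * κ * g⁻¹)
  · obtain ⟨t₀, ht₀, hT₀⟩ := hex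
    have ht₀0 : t₀ ≠ 0 := by
      rintro rfl
      rw [zero_mul, zero_mul] at hT₀
      exact not_trOne_zero h hT₀
    rw [Finset.sum_eq_single t₀]
    · rw [if_pos ht₀]
      have h1 := abs_goldSum h hN (w := t₀ * κ * g⁻¹)
      rw [abs_le] at h1
      rcases chi_eq_one_or t₀ with h2 | h2 <;> rw [h2] <;> linarith
    · intro t _ hne
      split_ifs with ht
      · rw [goldSum_eq_zero h, mul_zero]
        intro hT
        have h1 : t * κ * g⁻¹ = t / t₀ * (t₀ * κ * g⁻¹) := by field_simp
        rw [h1] at hT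
        have := hT₀.eq_one_of_mul h hT (div_mem ht ht₀)
        rw [div_eq_one_iff_eq ht₀0] at this
        exact hne this
      · rfl
    · intro h1
      exact absurd (mem_univ _) h1
  · push Not at hex
    rw [Finset.sum_eq_zero]
    · positivity
    · intro t _
      split_ifs with ht
      · rw [goldSum_eq_zero h (hex t ht), mul_zero]
      · rfl

open Classical in
theorem two_pow_sub_le_card_neg (h : GoldHyp K n k e) {N : ℕ} (hN : 2 * N = n + e)
    {κ b : K} (hκ : κ ≠ 0) (hb : b ≠ 0) :
    (2 : ℝ) ^ n - 2 ^ N ≤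
      2 * #{u : K | TrOne e (κ * u) ∧ chi K (b * u ^ (2 ^ k + 1)) = -1} * 2 ^ e := by
  have h1 := two_pow_mul_card_trOne h hκ
  have h2 := two_pow_mul_sum_trOne_chi_le h hN κ hb
  have h3 : 2 * (#{u : K | TrOne e (κ * u) ∧ chi K (b * u ^ (2 ^ k + 1)) = -1} : ℝ) =
      ∑ u : K, (if TrOne e (κ * u) then (1 : ℝ) else 0) -
      ∑ u : K, (if TrOne e (κ * u) then chi K (b * u ^ (2 ^ k + 1)) else 0) := by
    rw [← Finset.sum_boole, Finset.mul_sum, ← Finset.sum_sub_distrib]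
    refine Finset.sum_congr rfl fun u _ => ?_
    by_cases hT : TrOne e (κ * u)
    · rcases chi_eq_one_or (b * u ^ (2 ^ k + 1)) with h4 | h4 <;> simp [hT, h4] <;> norm_num
    · simp [hT]
  rw [h3]
  linarith

/-- The frequencies on the line `β = c α` with a negative contribution. -/
theorem exists_neg_frequencies (h : GoldHyp K n k e) {N : ℕ} (hN : 2 * N = n + e) {c b : K}
    (hc : c ∉ subfieldTwoPow K e) (hb : b ≠ 0) :
    ∃ s : Finset (K × K), (∀ p ∈ s, p ∈ genericSet K n k e c ∧ entryTerm k c b p ≤ 0) ∧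
      (2 : ℝ) ^ n - 2 ^ N ≤ 2 * s.card * 2 ^ e := by
  classical
  have hc0 := ne_zero_of_notMem hc
  have hc1 := add_one_ne_zero_of_notMem hc
  -- On β = cα one has α = τA and β = ρA, where A = α + β.
  set ρ := c / (c + 1) with hρ
  set τ := 1 / (c + 1) with hτ
  have hsum : τ + ρ = 1 := by
    rw [hτ, hρ]
    field_simp
    ring
  have hcτ : c * τ = ρ := by
    rw [hτ, hρ]
    ring
  have hcρ : c⁻¹ * ρ = τ := by
    rw [← hcτ]
    field_simp
  have hρF : ρ ∉ subfieldTwoPow K e := by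
    intro hmem
    apply hc
    have hτ' : τ = 1 - ρ := by rw [← hsum]; ring
    have hτm : τ ∈ subfieldTwoPow K e := hτ' ▸ sub_mem (one_mem _) hmem
    have : c = ρ / τ := by
      rw [hρ, hτ]
      field_simp
    rw [this]
    exact div_mem hmem hτm
  have hκ : ρ ^ 2 ^ (n - k) + ρ ≠ 0 := fun h0 => hρF (h.pow_sub_add_self_eq_zero.mp h0)
  -- As τ = 1 + ρ, the two trace conditions on this line coincide.
  have hκτ : τ ^ 2 ^ (n - k) + τ = ρ ^ 2 ^ (n - k) + ρ := by
    have hτ' : τ = 1 + ρ := by rw [← hsum, add_assoc, add_self, add_zero]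
    rw [hτ', add_pow_two_pow, one_pow]
    linear_combination CharTwo.two_eq_zero (R := K)
  set f : K → K × K := fun u => (τ * u ^ (2 ^ k + 1), ρ * u ^ (2 ^ k + 1)) with hf
  have hfadd : ∀ u, (f u).1 + (f u).2 = u ^ (2 ^ k + 1) := fun u => by
    simp only [hf]
    rw [← add_mul, hsum, one_mul]
  have hf1 : ∀ u, c * (f u).1 = (f u).2 := fun u => by
    simp only [hf]
    rw [← mul_assoc, hcτ]
  have hf2 : ∀ u, c⁻¹ * (f u).2 = (f u).1 := fun u => by
    simp only [hf]
    rw [← mul_assoc, hcρ]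
  have hinj : Function.Injective f := fun u v huv => h.gold_injective (by
    simp only
    rw [← hfadd, ← hfadd, huv])
  refine ⟨({u : K | TrOne e ((ρ ^ 2 ^ (n - k) + ρ) * u) ∧
    chi K (b * u ^ (2 ^ k + 1)) = -1} : Finset K).image f, ?_, ?_⟩
  · intro p hp
    rw [Finset.mem_image] at hp
    obtain ⟨u, hu, rfl⟩ := hp
    rw [Finset.mem_filter] at hu
    obtain ⟨-, hT, hu⟩ := hu
    refine ⟨⟨?_, ?_⟩, ?_⟩
    · have := (traceCond_slice_iff h ρ u).mpr hT
      change TraceCond _ _ _ _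
      rw [hfadd]
      exact this
    · rw [← hκτ] at hT
      have := (traceCond_slice_iff h τ u).mpr hT
      change TraceCond _ _ _ _
      rw [hf1, hf2, add_comm, hfadd]
      exact this
    -- The twisted pair is (β, α), so by symmetry of S the product of the two sums is a square.
    · rw [entryTerm, hfadd, hu, hf1, hf2, pairSum_comm (f u).2, ← sq]
      nlinarith [sq_nonneg (pairSum k (f u).1 (f u).2)]
  · rw [Finset.card_image_of_injective _ hinj]
    exact two_pow_sub_le_card_neg h hN hκ hb

end Slice

end CBoomerang

namespace CBoomerang

open Finset

/-! ### The generic set sliced by the slope r = γ'/γ. -/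

section GenericSet

variable {K : Type*} [Field K] [CharP K 2] [Fintype K] [DecidableEq K] {n k e : ℕ}

/-- The ratio `β / A` on the line of slope `r`. -/
def slopeRho (k : ℕ) (c r : K) : K := (c + c⁻¹)⁻¹ * (r ^ (2 ^ k + 1) + c)

/-- The ratio `c⁻¹ β / A'` on the line of slope `r`. -/
def slopeTau (k : ℕ) (c r : K) : K := c⁻¹ * slopeRho k c r / r ^ (2 ^ k + 1)

/-- The coefficient of the first trace condition on the line of slope `r`. -/
def slopeCoeff (n k : ℕ) (c r : K) : K := slopeRho k c r ^ 2 ^ (n - k) + slopeRho k c r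

/-- The coefficient of the second trace condition on the line of slope `r`. -/
def slopeCoeff' (n k : ℕ) (c r : K) : K :=
  (slopeTau k c r ^ 2 ^ (n - k) + slopeTau k c r) * r

/-- The pair of frequencies with `A = u ^ (2 ^ k + 1)` and `A' = (r u) ^ (2 ^ k + 1)`. -/
def slopePair (k : ℕ) (c : K) (z : K × K) : K × K :=
  ((1 + slopeRho k c z.1) * z.2 ^ (2 ^ k + 1), slopeRho k c z.1 * z.2 ^ (2 ^ k + 1))

theorem slopePair_add (c : K) (z : K × K) :
    (slopePair k c z).1 + (slopePair k c z).2 = z.2 ^ (2 ^ k + 1) := by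
  simp only [slopePair]
  linear_combination slopeRho k c z.1 * z.2 ^ (2 ^ k + 1) * CharTwo.two_eq_zero (R := K)

theorem slopePair_twist_add {c : K} (hc : c + c⁻¹ ≠ 0) (z : K × K) :
    c * (slopePair k c z).1 + c⁻¹ * (slopePair k c z).2 = (z.1 * z.2) ^ (2 ^ k + 1) := by
  have h1 : (c + c⁻¹) * slopeRho k c z.1 = z.1 ^ (2 ^ k + 1) + c := by
    rw [slopeRho, mul_inv_cancel_left₀ hc]
  simp only [slopePair]
  rw [mul_pow]
  linear_combination z.2 ^ (2 ^ k + 1) * h1 + c * z.2 ^ (2 ^ k + 1) * CharTwo.two_eq_zero (R := K)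

theorem slopePair_mem_genericSet_iff (h : GoldHyp K n k e) {c : K}
    (hc : c ∉ subfieldTwoPow K e) {z : K × K} (hz : z.1 ≠ 0) :
    slopePair k c z ∈ genericSet K n k e c ↔
      TrOne e (slopeCoeff n k c z.1 * z.2) ∧ TrOne e (slopeCoeff' n k c z.1 * z.2) := by
  have hD := add_inv_ne_zero_of_notMem hc
  refine and_congr ?_ ?_
  · rw [slopeCoeff, ← traceCond_slice_iff h]
    change TraceCond _ _ _ _ ↔ _
    rw [slopePair_add]
    rfl
  · rw [slopeCoeff', mul_assoc, ← traceCond_slice_iff h]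
    change TraceCond _ _ _ _ ↔ _
    rw [slopePair_twist_add hD]
    have : c⁻¹ * (slopePair k c z).2 = slopeTau k c z.1 * (z.1 * z.2) ^ (2 ^ k + 1) := by
      simp only [slopePair, slopeTau]
      rw [mul_pow]
      have := pow_ne_zero (2 ^ k + 1) hz
      field_simp
    rw [this]

-- A generic frequency is determined by the roots γ = u and γ' = r u of A and A', because (α, β) ↦
-- (A, A') is invertible when c + c⁻¹ ≠ 0. For fixed r both trace conditions depend on u through
-- linear forms.
open Classical in
theorem ncard_genericSet (h : GoldHyp K n k e) {c : K} (hc : c ∉ subfieldTwoPow K e) :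
    (genericSet K n k e c).ncard = ∑ r with r ≠ 0,
      #{u : K | TrOne e (slopeCoeff n k c r * u) ∧ TrOne e (slopeCoeff' n k c r * u)} := by
  have hD := add_inv_ne_zero_of_notMem hc
  have hset : (genericSet K n k e c).ncard = #{z : K × K | z.1 ≠ 0 ∧
      (TrOne e (slopeCoeff n k c z.1 * z.2) ∧ TrOne e (slopeCoeff' n k c z.1 * z.2))} := by
    rw [← Set.ncard_coe_finset]
    symm
    refine Set.ncard_congr (fun z _ => slopePair k c z) ?_ ?_ ?_
    · intro z hz
      simp only [Finset.coe_filter, Finset.mem_univ, true_and, Set.mem_ofPred_eq] at hz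
      exact (slopePair_mem_genericSet_iff h hc hz.1).mpr hz.2
    · intro z z' hz hz' heq
      simp only [Finset.coe_filter, Finset.mem_univ, true_and, Set.mem_ofPred_eq] at hz hz'
      have hu : z.2 = z'.2 := h.gold_injective (by
        simp only
        rw [← slopePair_add c z, ← slopePair_add c z', heq])
      have hru : z.1 * z.2 = z'.1 * z'.2 := h.gold_injective (by
        simp only
        rw [← slopePair_twist_add hD z, ← slopePair_twist_add hD z', heq])
      have hu0 : z'.2 ≠ 0 := by
        intro h0
        have := hz'.2.1
        rw [h0, mul_zero] at this
        exact not_trOne_zero h this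
      rw [hu] at hru
      exact Prod.ext (mul_right_cancel₀ hu0 hru) hu
    · rintro ⟨α, β⟩ hp
      obtain ⟨u, hu⟩ := h.exists_root (α + β)
      obtain ⟨v, hv⟩ := h.exists_root (c * α + c⁻¹ * β)
      have hu0 := root_ne_zero hp.1.1 hu
      have hv0 := root_ne_zero hp.2.1 hv
      have hr0 : v / u ≠ 0 := div_ne_zero hv0 hu0
      have hβ : slopeRho k c (v / u) * u ^ (2 ^ k + 1) = β := by
        have hu1 := pow_ne_zero (2 ^ k + 1) hu0
        have : (v / u) ^ (2 ^ k + 1) * u ^ (2 ^ k + 1) = v ^ (2 ^ k + 1) := by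
          rw [← mul_pow, div_mul_cancel₀ _ hu0]
        rw [slopeRho, mul_assoc, inv_mul_eq_iff_eq_mul₀ hD, add_mul, this, hu, hv]
        linear_combination c * α * CharTwo.two_eq_zero (R := K)
      have hpair : slopePair k c (v / u, u) = (α, β) := by
        simp only [slopePair]
        rw [add_mul, hβ, one_mul, hu, add_assoc, add_self, add_zero]
      refine ⟨(v / u, u), ?_, hpair⟩
      simp only [Finset.coe_filter, Finset.mem_univ, true_and, Set.mem_ofPred_eq]
      refine ⟨hr0, ?_⟩
      rw [← hpair, slopePair_mem_genericSet_iff h hc hr0] at hp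
      exact hp
  rw [hset, Finset.card_filter, Fintype.sum_prod_type, Finset.sum_filter]
  refine Finset.sum_congr rfl fun r _ => ?_
  rw [Finset.card_filter]
  by_cases hr : r = 0 <;> simp [hr]

end GenericSet

/-! ### Generic counts for e = 1 and n = 3, 5. -/

section DegreeOne

variable {K : Type*} [Field K] [CharP K 2] [Fintype K] [DecidableEq K] {n k : ℕ}

theorem mem_subfieldTwoPow_one_iff {x : K} : x ∈ subfieldTwoPow K 1 ↔ x = 0 ∨ x = 1 := by
  rw [mem_subfieldTwoPow, pow_one]
  constructor
  · intro hx
    have : x * (x - 1) = 0 := by linear_combination hx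
    rcases mul_eq_zero.mp this with h | h
    · exact Or.inl h
    · exact Or.inr (sub_eq_zero.mp h)
  · rintro (rfl | rfl) <;> simp

theorem chi_one (h : GoldHyp K n k 1) : chi K (1 : K) = -1 := by
  refine (chi_eq_one_or (1 : K)).resolve_left fun h1 => not_trOne_zero h fun t ht => ?_
  rw [mul_zero, chi_zero]
  rcases mem_subfieldTwoPow_one_iff.mp ht with rfl | rfl
  · rw [chi_zero]
  · rw [h1]

theorem trOne_one_iff (h : GoldHyp K n k 1) {x : K} : TrOne 1 x ↔ chi K x = -1 := by
  constructor
  · intro hx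
    have := hx 1 (one_mem _)
    rwa [one_mul, chi_one h] at this
  · intro hx t ht
    rcases mem_subfieldTwoPow_one_iff.mp ht with rfl | rfl
    · rw [zero_mul]
    · rw [one_mul, hx, chi_one h]

-- For e = 1 the condition reads χ = -1, and four times the indicator of both conditions is (1 -
-- χ(κ₁u))(1 - χ(κ₂u)).
open Classical in
theorem four_mul_card_trOne (h : GoldHyp K n k 1) (κ₁ κ₂ : K) :
    (4 * #{u : K | TrOne 1 (κ₁ * u) ∧ TrOne 1 (κ₂ * u)} : ℝ) =
      2 ^ n * (1 - (if κ₁ = 0 then 1 else 0) - (if κ₂ = 0 then 1 else 0) +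
        (if κ₁ + κ₂ = 0 then 1 else 0)) := by
  have hterm : ∀ u : K, (4 : ℝ) * (if TrOne 1 (κ₁ * u) ∧ TrOne 1 (κ₂ * u) then 1 else 0) =
      chi K (u * 0) - chi K (u * κ₁) - chi K (u * κ₂) + chi K (u * (κ₁ + κ₂)) := by
    intro u
    rw [trOne_one_iff h, trOne_one_iff h, mul_add, chi_add, mul_zero, chi_zero,
      mul_comm κ₁, mul_comm κ₂]
    rcases chi_eq_one_or (u * κ₁) with h1 | h1 <;> rcases chi_eq_one_or (u * κ₂) with h2 | h2 <;>
      rw [h1, h2] <;> norm_num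
  rw [← Finset.sum_boole, Finset.mul_sum, Finset.sum_congr rfl fun u _ => hterm u,
    Finset.sum_add_distrib, Finset.sum_sub_distrib, Finset.sum_sub_distrib]
  simp only [sum_chi_mul, h.cast_card]
  split_ifs <;> ring

open Classical in
theorem eight_dvd_ncard_genericSet (h : GoldHyp K 5 k 1) {c : K}
    (hc : c ∉ subfieldTwoPow K 1) : 8 ∣ (genericSet K 5 k 1 c).ncard := by
  rw [ncard_genericSet h hc]
  refine Finset.dvd_sum fun r _ => ?_
  have h4 := four_mul_card_trOne h (slopeCoeff 5 k c r) (slopeCoeff' 5 k c r)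
  have h5 : ∃ j : ℤ, (4 * #{u : K | TrOne 1 (slopeCoeff 5 k c r * u) ∧
      TrOne 1 (slopeCoeff' 5 k c r * u)} : ℝ) = 32 * j := by
    refine ⟨1 - (if slopeCoeff 5 k c r = 0 then 1 else 0) -
      (if slopeCoeff' 5 k c r = 0 then 1 else 0) +
      (if slopeCoeff 5 k c r + slopeCoeff' 5 k c r = 0 then 1 else 0), ?_⟩
    rw [h4]
    push_cast
    norm_num
  obtain ⟨j, hj⟩ := h5
  norm_cast at hj
  omega

-- A slope r ≠ 0 with both coefficients nonzero contributes at least 8/4 = 2. The exceptions ρ = 0,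
-- ρ = 1 and τ = 1 each exclude at most one r, so at least four of the eight elements are good.
open Classical in
theorem eight_le_ncard_genericSet (h : GoldHyp K 3 k 1) {c : K}
    (hc : c ∉ subfieldTwoPow K 1) : 8 ≤ (genericSet K 3 k 1 c).ncard := by
  have hD := add_inv_ne_zero_of_notMem hc
  have hc0 := ne_zero_of_notMem hc
  have hcard : Fintype.card K = 8 := by
    rw [← Nat.card_eq_fintype_card, h.card]
    norm_num
  have hρinj : ∀ r r' : K, slopeRho k c r = slopeRho k c r' → r = r' := by
    intro r r' hr
    have h1 := mul_left_cancel₀ (inv_ne_zero hD) hr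
    exact h.gold_injective (add_right_cancel h1)
  have hτ1 : ∀ r : K, r ≠ 0 → slopeTau k c r = 1 →
      r ^ (2 ^ k + 1) * (c * (c + c⁻¹) - 1) = c := by
    intro r hr h1
    have hp := pow_ne_zero (2 ^ k + 1) hr
    rw [slopeTau, div_eq_one_iff_eq hp, slopeRho] at h1
    have hcancel : ∀ D w : K, D ≠ 0 → c * D * (c⁻¹ * (D⁻¹ * w)) = w := fun D w hD => by
      field_simp
    have h2 := hcancel (c + c⁻¹) (r ^ (2 ^ k + 1) + c) hD
    rw [h1] at h2
    linear_combination h2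
  have hτinj : ∀ r r' : K, r ≠ 0 → r' ≠ 0 → slopeTau k c r = 1 → slopeTau k c r' = 1 → r = r' := by
    intro r r' hr hr' h1 h2
    have h3 := hτ1 r hr h1
    have h4 := hτ1 r' hr' h2
    have h5 : c * (c + c⁻¹) - 1 ≠ 0 := by
      intro h0
      rw [h0, mul_zero] at h3
      exact hc0 h3.symm
    exact h.gold_injective (mul_right_cancel₀ h5 (h3.trans h4.symm))
  have hgood : ∀ r : K, r ≠ 0 → slopeRho k c r ≠ 0 → slopeRho k c r ≠ 1 → slopeTau k c r ≠ 1 →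
      2 ≤ #{u : K | TrOne 1 (slopeCoeff 3 k c r * u) ∧ TrOne 1 (slopeCoeff' 3 k c r * u)} := by
    intro r hr h0 h1 h2
    have hτ0 : slopeTau k c r ≠ 0 :=
      div_ne_zero (mul_ne_zero (inv_ne_zero hc0) h0) (pow_ne_zero _ hr)
    have hκ : slopeCoeff 3 k c r ≠ 0 := by
      rw [slopeCoeff, ne_eq, h.pow_sub_add_self_eq_zero, mem_subfieldTwoPow_one_iff]
      tauto
    have hκ' : slopeCoeff' 3 k c r ≠ 0 := by
      rw [slopeCoeff']
      refine mul_ne_zero ?_ hr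
      rw [ne_eq, h.pow_sub_add_self_eq_zero, mem_subfieldTwoPow_one_iff]
      tauto
    have h4 := four_mul_card_trOne h (slopeCoeff 3 k c r) (slopeCoeff' 3 k c r)
    rw [if_neg hκ, if_neg hκ'] at h4
    have h5 : (2 : ℝ) ≤ #{u : K | TrOne 1 (slopeCoeff 3 k c r * u) ∧
        TrOne 1 (slopeCoeff' 3 k c r * u)} := by
      split_ifs at h4 <;> linarith
    exact_mod_cast h5
  rw [ncard_genericSet h hc]
  set bad : Finset K := {0} ∪ ({r | slopeRho k c r = 0} : Finset K) ∪
    ({r | slopeRho k c r = 1} : Finset K) ∪ ({r | r ≠ 0 ∧ slopeTau k c r = 1} : Finset K) with hbad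
  have hbadcard : #bad ≤ 4 := by
    have h1 : #({r | slopeRho k c r = 0} : Finset K) ≤ 1 := Finset.card_le_one.mpr (by
      intro r hr r' hr'
      rw [Finset.mem_filter] at hr hr'
      exact hρinj r r' (hr.2.trans hr'.2.symm))
    have h2 : #({r | slopeRho k c r = 1} : Finset K) ≤ 1 := Finset.card_le_one.mpr (by
      intro r hr r' hr'
      rw [Finset.mem_filter] at hr hr'
      exact hρinj r r' (hr.2.trans hr'.2.symm))
    have h3 : #({r | r ≠ 0 ∧ slopeTau k c r = 1} : Finset K) ≤ 1 := Finset.card_le_one.mpr (by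
      intro r hr r' hr'
      rw [Finset.mem_filter] at hr hr'
      exact hτinj r r' hr.2.1 hr'.2.1 hr.2.2 hr'.2.2)
    calc #bad ≤ 1 + 1 + 1 + 1 := by
          refine (Finset.card_union_le _ _).trans (Nat.add_le_add ?_ h3)
          refine (Finset.card_union_le _ _).trans (Nat.add_le_add ?_ h2)
          refine (Finset.card_union_le _ _).trans (Nat.add_le_add ?_ h1)
          simp
      _ = 4 := rfl
  have hgoodcard : 4 ≤ #badᶜ := by
    rw [Finset.card_compl, hcard]
    omega
  have hmem : ∀ r ∈ badᶜ, r ≠ 0 ∧ slopeRho k c r ≠ 0 ∧ slopeRho k c r ≠ 1 ∧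
      slopeTau k c r ≠ 1 := by
    intro r hr
    simp only [hbad, Finset.mem_compl, Finset.mem_union, Finset.mem_singleton, Finset.mem_filter,
      Finset.mem_univ, true_and] at hr
    tauto
  calc 8 ≤ #badᶜ • 2 := by rw [smul_eq_mul]; omega
    _ ≤ ∑ r ∈ badᶜ, #{u : K | TrOne 1 (slopeCoeff 3 k c r * u) ∧
          TrOne 1 (slopeCoeff' 3 k c r * u)} :=
        Finset.card_nsmul_le_sum _ _ _ fun r hr =>
          hgood r (hmem r hr).1 (hmem r hr).2.1 (hmem r hr).2.2.1 (hmem r hr).2.2.2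
    _ ≤ _ := Finset.sum_le_sum_of_subset fun r hr => by
        rw [Finset.mem_filter]
        exact ⟨mem_univ _, (hmem r hr).1⟩

end DegreeOne

end CBoomerang

/-! ### A computable model of 𝔽_8 and the finite check. -/

namespace CBoomerang

open Finset

/-- Coordinates with respect to `1, θ, θ ^ 2` where `θ ^ 3 = θ + 1`. -/
abbrev Octet := Bool × Bool × Bool

namespace Octet

def add (x y : Octet) : Octet := (x.1 ^^ y.1, x.2.1 ^^ y.2.1, x.2.2 ^^ y.2.2)

def mul (x y : Octet) : Octet :=
  ((x.1 && y.1) ^^ ((x.2.1 && y.2.2) ^^ (x.2.2 && y.2.1)),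
    ((x.1 && y.2.1) ^^ (x.2.1 && y.1)) ^^
      (((x.2.1 && y.2.2) ^^ (x.2.2 && y.2.1)) ^^ (x.2.2 && y.2.2)),
    ((x.1 && y.2.2) ^^ ((x.2.1 && y.2.1) ^^ (x.2.2 && y.1))) ^^ (x.2.2 && y.2.2))

def zero : Octet := (false, false, false)

def one : Octet := (true, false, false)

def cube (x : Octet) : Octet := mul (mul x x) x

def fifth (x : Octet) : Octet := mul (mul (mul x x) (mul x x)) x

-- This is the exponent for k = 1. The second equation is multiplied by c, which avoids an inverse
-- in the model.
set_option maxRecDepth 100000 in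
theorem card_cube_le : ∀ c : Octet, c ≠ zero → c ≠ one → ∀ b : Octet, b ≠ zero →
    (univ.filter fun z : Octet × Octet => add (cube z.1) (mul c (cube z.2)) = b ∧
      add (mul c (cube (add z.1 one))) (cube (add z.2 one)) = mul c b).card ≤ 2 := by
  decide

set_option maxRecDepth 100000 in
theorem card_fifth_le : ∀ c : Octet, c ≠ zero → c ≠ one → ∀ b : Octet, b ≠ zero →
    (univ.filter fun z : Octet × Octet => add (fifth z.1) (mul c (fifth z.2)) = b ∧
      add (mul c (fifth (add z.1 one))) (fifth (add z.2 one)) = mul c b).card ≤ 2 := by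
  decide

theorem exists_mul_eq_one : ∀ x : Octet, x ≠ zero → ∃ y, mul x y = one := by
  decide

variable {K : Type*} [Field K] [CharP K 2]

/-- The element `1` or `0` of `K`, as `x` is true or false. -/
def bit (K : Type*) [Field K] (x : Bool) : K := if x then 1 else 0

theorem bit_xor (x y : Bool) : bit K (x ^^ y) = bit K x + bit K y := by
  cases x <;> cases y <;> simp [bit, CharTwo.add_self_eq_zero]

theorem bit_and (x y : Bool) : bit K (x && y) = bit K x * bit K y := by
  cases x <;> cases y <;> simp [bit]

/-- The element with the given coordinates. -/
def toField (θ : K) (x : Octet) : K := bit K x.1 + bit K x.2.1 * θ + bit K x.2.2 * θ ^ 2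

theorem toField_zero (θ : K) : toField θ zero = 0 := by simp [toField, zero, bit]

theorem toField_one (θ : K) : toField θ one = 1 := by simp [toField, one, bit]

theorem toField_add (θ : K) (x y : Octet) : toField θ (add x y) = toField θ x + toField θ y := by
  simp only [toField, add, bit_xor]
  ring

theorem toField_mul {θ : K} (hθ : θ ^ 3 = θ + 1) (x y : Octet) :
    toField θ (mul x y) = toField θ x * toField θ y := by
  simp only [toField, mul, bit_xor, bit_and]
  generalize bit K x.1 = a₀
  generalize bit K x.2.1 = a₁
  generalize bit K x.2.2 = a₂
  generalize bit K y.1 = b₀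
  generalize bit K y.2.1 = b₁
  generalize bit K y.2.2 = b₂
  linear_combination -(a₁ * b₂ + a₂ * b₁ + a₂ * b₂ * θ) * hθ

theorem toField_cube {θ : K} (hθ : θ ^ 3 = θ + 1) (x : Octet) :
    toField θ (cube x) = toField θ x ^ 3 := by
  rw [cube, toField_mul hθ, toField_mul hθ]
  ring

theorem toField_fifth {θ : K} (hθ : θ ^ 3 = θ + 1) (x : Octet) :
    toField θ (fifth x) = toField θ x ^ 5 := by
  rw [fifth, toField_mul hθ, toField_mul hθ, toField_mul hθ]
  ring

theorem toField_injective {θ : K} (hθ : θ ^ 3 = θ + 1) : Function.Injective (toField θ) := by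
  have hadd : ∀ x y : Octet, x ≠ y → add x y ≠ zero := by decide
  intro x y hxy
  by_contra hne
  obtain ⟨z, hz⟩ := exists_mul_eq_one _ (hadd x y hne)
  have := congrArg (toField θ) hz
  rw [toField_mul hθ, toField_add, hxy, add_self, zero_mul, toField_one] at this
  exact zero_ne_one this

theorem exists_root_cubic [Finite K] (hcard : Nat.card K = 8) : ∃ θ : K, θ ^ 3 = θ + 1 := by
  have := Fintype.ofFinite K
  classical
  rw [Nat.card_eq_fintype_card] at hcard
  obtain ⟨x, hx⟩ : ∃ x : K, x ∉ ({0, 1} : Finset K) := by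
    by_contra hall
    push Not at hall
    have h1 : (univ : Finset K) ⊆ {0, 1} := fun x _ => hall x
    have h2 := (Finset.card_le_card h1).trans Finset.card_le_two
    rw [Finset.card_univ, hcard] at h2
    omega
  simp only [Finset.mem_insert, Finset.mem_singleton, not_or] at hx
  obtain ⟨hx0, hx1⟩ := hx
  have h8 : x ^ 8 = x := by rw [← hcard, FiniteField.pow_card]
  have hx1' : x + 1 ≠ 0 := fun h0 => hx1 (eq_of_add_eq_zero h0)
  -- Modulo 2 this is the factorisation of x^8 - x. The two cubics are reciprocal, so the inverse of
  -- a root of one is a root of the other.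
  have hprod : x * (x + 1) * ((x ^ 3 + x + 1) * (x ^ 3 + x ^ 2 + 1)) = 0 := by
    linear_combination h8 +
      (x ^ 2 + x ^ 3 + x ^ 4 * 2 + x ^ 5 * 2 + x ^ 6 + x ^ 7 + x) * CharTwo.two_eq_zero (R := K)
  rcases mul_eq_zero.mp ((mul_eq_zero.mp hprod).resolve_left (mul_ne_zero hx0 hx1')) with h | h
  · exact ⟨x, eq_of_add_eq_zero (by linear_combination h)⟩
  · refine ⟨x⁻¹, eq_of_add_eq_zero ?_⟩
    have h3 : x ^ 3 * (x⁻¹ ^ 3 + (x⁻¹ + 1)) = 0 := by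
      rw [← h]
      field_simp
      ring
    exact (mul_eq_zero.mp h3).resolve_left (pow_ne_zero _ hx0)

theorem toField_surjective [Finite K] (hcard : Nat.card K = 8) {θ : K} (hθ : θ ^ 3 = θ + 1) :
    Function.Surjective (toField θ) := by
  have := Fintype.ofFinite K
  rw [Nat.card_eq_fintype_card] at hcard
  refine ((Fintype.bijective_iff_injective_and_card _).mpr ⟨toField_injective hθ, ?_⟩).2
  rw [hcard]
  rfl

theorem cBCT_le_two_of_octet [Finite K] (hcard : Nat.card K = 8) {θ : K} (hθ : θ ^ 3 = θ + 1)
    {m : ℕ} {P : Octet → Octet} (hP : ∀ x, toField θ (P x) = toField θ x ^ m)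
    (hle : ∀ c : Octet, c ≠ zero → c ≠ one → ∀ b : Octet, b ≠ zero →
      (univ.filter fun z : Octet × Octet => add (P z.1) (mul c (P z.2)) = b ∧
        add (mul c (P (add z.1 one))) (P (add z.2 one)) = mul c b).card ≤ 2)
    {c b : K} (hc0 : c ≠ 0) (hc1 : c ≠ 1) (hb : b ≠ 0) :
    cBCT (fun x : K => x ^ m) c 1 b ≤ 2 := by
  have hsurj := toField_surjective hcard hθ
  obtain ⟨c, rfl⟩ := hsurj c
  obtain ⟨b, rfl⟩ := hsurj b
  have h1 := hle c (fun h => hc0 (by rw [h, toField_zero])) (fun h => hc1 (by rw [h, toField_one]))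
    b (fun h => hb (by rw [h, toField_zero]))
  refine le_trans ?_ h1
  rw [cBCT, ← Set.ncard_coe_finset]
  refine (Set.ncard_le_ncard ?_ (Set.toFinite _)).trans
    (Set.ncard_image_le (f := fun z : Octet × Octet => (toField θ z.1, toField θ z.2))
      (Set.toFinite _))
  rintro ⟨x, y⟩ ⟨h2, h3⟩
  obtain ⟨x, rfl⟩ := hsurj x
  obtain ⟨y, rfl⟩ := hsurj y
  refine ⟨(x, y), ?_, rfl⟩
  simp only [Finset.coe_filter, Finset.mem_univ, true_and, Set.mem_ofPred_eq]
  simp only [CharTwo.sub_eq_add] at h2 h3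
  constructor <;> apply toField_injective hθ
  · rw [toField_add, toField_mul hθ, hP, hP, h2]
  · rw [toField_add, toField_mul hθ, toField_mul hθ, hP, hP, toField_add, toField_add, toField_one,
      ← h3]
    field_simp

end Octet

theorem cBCT_gold_le_two {K : Type*} [Field K] [CharP K 2] [Finite K] {k : ℕ}
    (h : GoldHyp K 3 k 1) {c b : K} (hc : c ∉ subfieldTwoPow K 1) (hb : b ≠ 0) :
    cBCT (fun x : K => x ^ (2 ^ k + 1)) c 1 b ≤ 2 := by
  have := Fintype.ofFinite K
  classical
  have hcard : Nat.card K = 8 := h.card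
  obtain ⟨θ, hθ⟩ := Octet.exists_root_cubic hcard
  have hc0 := ne_zero_of_notMem hc
  have hc1 : c ≠ 1 := fun h1 => hc (h1 ▸ one_mem _)
  have hk1 := h.one_le
  have hk2 := h.lt
  obtain rfl | rfl : k = 1 ∨ k = 2 := by omega
  · exact Octet.cBCT_le_two_of_octet hcard hθ (Octet.toField_cube hθ) Octet.card_cube_le hc0 hc1 hb
  · exact Octet.cBCT_le_two_of_octet hcard hθ (Octet.toField_fifth hθ) Octet.card_fifth_le
      hc0 hc1 hb

end CBoomerang

namespace CBoomerang

open Finset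

/-! ### The bound with the negative sign, and the theorem. -/

section Main

variable {K : Type*} [Field K] [CharP K 2] [Fintype K] [DecidableEq K] {n k e : ℕ}

theorem cBCT_mul_le (h : GoldHyp K n k e) {N : ℕ} (hN : 2 * N = n + e) {c : K}
    (hc : c ∉ subfieldTwoPow K e) (b : K) (s : Finset (K × K))
    (hs : ∀ p ∈ s, p ∈ genericSet K n k e c ∧ entryTerm k c b p ≤ 0) :
    (cBCT (fun x : K => x ^ (2 ^ k + 1)) c 1 b : ℝ) * 2 ^ n ≤ 2 ^ n +
      (mixedSet K n k e c).ncard * 2 ^ N +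
      ((genericSet K n k e c).ncard - 2 * (s.card : ℝ)) * 2 ^ e := by
  have h1 := cBCT_mul_sq_le h hN hc b s hs
  have hq : (0 : ℝ) < 2 ^ n := by positivity
  refine le_of_mul_le_mul_right ?_ hq
  linarith

/-- The gain 2·|s|·2^e from the negative frequencies has to outweigh twice the mixed contribution,
which is at most 4·2^N. -/
theorem cBCT_mul_le_sub (h : GoldHyp K n k e) {N : ℕ} (hN : 2 * N = n + e) {c b : K}
    (hc : c ∉ subfieldTwoPow K e) (hb : b ≠ 0) (hodd : Odd e) :
    (cBCT (fun x : K => x ^ (2 ^ k + 1)) c 1 b : ℝ) * 2 ^ n ≤ 2 ^ n -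
      (mixedSet K n k e c).ncard * 2 ^ N + (genericSet K n k e c).ncard * 2 ^ e := by
  obtain ⟨s, hs, hcard⟩ := exists_neg_frequencies h hN hc hb
  have hle := cBCT_mul_le h hN hc b s hs
  have hU := ncard_mixedSet_le (n := n) (k := k) h (ne_zero_of_notMem hc)
  obtain ⟨m, hm⟩ := h.dvd_n
  have hmodd := h.odd
  rw [hm, Nat.mul_div_cancel_left _ h.pos] at hmodd
  have hen : e < n := lt_of_le_of_lt (Nat.le_of_dvd h.one_le h.dvd_k) h.lt
  have hm3 : 3 ≤ m := by
    obtain ⟨j, rfl⟩ := hmodd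
    rcases Nat.eq_zero_or_pos j with rfl | hj
    · simp at hm
      omega
    · omega
  by_cases hlarge : N + 3 ≤ n
  · obtain ⟨l, rfl⟩ := Nat.exists_eq_add_of_le hlarge
    have h1 : (8 : ℝ) * 2 ^ N ≤ 2 ^ (N + 3 + l) := by
      have : (1 : ℝ) ≤ 2 ^ l := one_le_pow₀ (by norm_num)
      rw [pow_add, pow_add]
      nlinarith [show (0 : ℝ) < 2 ^ N by positivity]
    have h2 : ((mixedSet K (N + 3 + l) k e c).ncard : ℝ) * 2 ^ N ≤ 2 * 2 ^ N :=
      mul_le_mul_of_nonneg_right (by exact_mod_cast hU) (by positivity)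
    have h3 : (0 : ℝ) < 2 ^ N := by positivity
    linarith
  -- With n = e m and m ≥ 3 odd, n - N = e(m - 1)/2; for odd e this is below 3 only if e = 1 and m
  -- is 3 or 5.
  · have he1 : e = 1 := by
      by_contra hne
      have he3 : 3 ≤ e := by
        have := h.pos
        obtain ⟨j, rfl⟩ := hodd
        omega
      have : e * 3 ≤ e * m := Nat.mul_le_mul_left _ hm3
      omega
    subst he1
    have hn : n = 3 ∨ n = 5 := by
      obtain ⟨j, rfl⟩ := hmodd
      omega
    rcases hn with rfl | rfl
    · obtain rfl : N = 2 := by omega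
      have hT : (cBCT (fun x : K => x ^ (2 ^ k + 1)) c 1 b : ℝ) ≤ 2 := by
        exact_mod_cast cBCT_gold_le_two h hc hb
      have hG : (8 : ℝ) ≤ (genericSet K 3 k 1 c).ncard := by
        exact_mod_cast eight_le_ncard_genericSet h hc
      have hU' : ((mixedSet K 3 k 1 c).ncard : ℝ) ≤ 2 := by exact_mod_cast hU
      -- The three bounds meet exactly: 2·8 = 8 - 2·4 + 8·2.
      linarith
    · obtain rfl : N = 3 := by omega
      obtain ⟨j, hj⟩ := eight_dvd_ncard_genericSet h hc
      rw [hj] at hle ⊢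
      generalize cBCT (fun x : K => x ^ (2 ^ k + 1)) c 1 b = T at hle ⊢
      generalize (mixedSet K 5 k 1 c).ncard = U at hU hle ⊢
      generalize s.card = S at hcard hle
      have h1 : 24 ≤ 4 * S := by
        have : (24 : ℝ) ≤ 4 * S := by linarith
        exact_mod_cast this
      have h2 : T * 32 + 4 * S ≤ 32 + U * 8 + 8 * j * 2 := by
        have : (T * 32 + 4 * S : ℝ) ≤ 32 + U * 8 + 8 * j * 2 := by
          push_cast at hle
          linarith
        exact_mod_cast this
      -- With two mixed frequencies the real estimate misses by 8; as 32T and 16j are multiples of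
      -- 16, it can be rounded down by 8.
      have h3 : T * 32 + U * 8 ≤ 32 + 8 * j * 2 := by omega
      have h4 : (T * 32 + U * 8 : ℝ) ≤ 32 + 8 * j * 2 := by exact_mod_cast h3
      push_cast
      linarith

theorem two_rpow_half_sub {N : ℕ} (hN : 2 * N = n + e) :
    (2 : ℝ) ^ (((e : ℝ) - (n : ℝ)) / 2) = 2 ^ N / 2 ^ n := by
  have h1 : ((e : ℝ) - (n : ℝ)) / 2 = (N : ℝ) - (n : ℝ) := by
    have : (2 * N : ℝ) = n + e := by exact_mod_cast hN
    linarith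
  rw [h1, Real.rpow_sub two_pos, Real.rpow_natCast, Real.rpow_natCast]

end Main

end CBoomerang

theorem mainTheorem10 {K : Type*} [Field K] [Finite K] [CharP K 2] (n k e : ℕ)
    (hcard : Nat.card K = 2 ^ n) (hk1 : 1 ≤ k) (hkn : k < n) (he : e = Nat.gcd k n)
    (hodd : Odd (n / e)) (c : K) (hc : c ∉ CBoomerang.subfieldTwoPow K e) :
    (CBoomerang.cBoomerangUniformity (fun x : K => x ^ (2 ^ k + 1)) c : ℝ) ≤
      1 + (jacobiSym 2 (n / e) : ℝ) ^ e * (2 : ℝ) ^ (((e : ℝ) - (n : ℝ)) / 2) *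
          (((CBoomerang.setA K e ∩ CBoomerang.setF' n k e c) ∪
            (CBoomerang.setA' e c ∩ CBoomerang.setF K n k e)).ncard : ℝ) +
        (2 : ℝ) ^ ((e : ℝ) - (n : ℝ)) *
          ((CBoomerang.setF K n k e ∩ CBoomerang.setF' n k e c).ncard : ℝ) := by
  have := Fintype.ofFinite K
  classical
  have h : CBoomerang.GoldHyp K n k e := ⟨hcard, hk1, hkn, he, hodd⟩
  -- Here n + e = e(n/e + 1) is even because n / e is odd.
  obtain ⟨N, hN⟩ : ∃ N, 2 * N = n + e := by
    obtain ⟨m, hm⟩ := h.dvd_n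
    have hm' := hodd
    rw [hm, Nat.mul_div_cancel_left _ h.pos] at hm'
    obtain ⟨j, rfl⟩ := hm'
    exact ⟨e * (j + 1), by rw [hm]; ring⟩
  obtain ⟨a, b, ha, hb, hab⟩ :=
    (CBoomerang.isGreatest_cBoomerangUniformity (fun x : K => x ^ (2 ^ k + 1)) c).1
  have hb' : b / a ^ (2 ^ k + 1) ≠ 0 := div_ne_zero hb (pow_ne_zero _ ha)
  rw [hab, CBoomerang.cBCT_scale c a b ha, CBoomerang.two_rpow_half_sub hN,
    Real.rpow_sub two_pos, Real.rpow_natCast, Real.rpow_natCast]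
  change _ ≤ 1 + _ * _ * ((CBoomerang.mixedSet K n k e c).ncard : ℝ) +
    _ * ((CBoomerang.genericSet K n k e c).ncard : ℝ)
  have hq : (0 : ℝ) < 2 ^ n := by positivity
  have hcop : Int.gcd 2 ((n / e : ℕ) : ℤ) = 1 :=
    Nat.Coprime.gcd_eq_one (Nat.coprime_two_left.mpr hodd)
  have hJ : (jacobiSym 2 (n / e) : ℝ) ^ e = 1 ∨
      ((jacobiSym 2 (n / e) : ℝ) ^ e = -1 ∧ Odd e) := by
    rcases jacobiSym.eq_one_or_neg_one hcop with hJ | hJ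
    · left
      rw [hJ]
      simp
    · rw [hJ]
      push_cast
      rcases Nat.even_or_odd e with h1 | h1
      · exact Or.inl h1.neg_one_pow
      · exact Or.inr ⟨h1.neg_one_pow, h1⟩
  refine le_of_mul_le_mul_right ?_ hq
  rcases hJ with hJ | ⟨hJ, hoe⟩
  -- With sign +1 the plain triangle inequality suffices, so no negative frequencies are supplied.
  · have h1 := CBoomerang.cBCT_mul_le h hN hc (b / a ^ (2 ^ k + 1)) ∅ (by simp)
    refine h1.trans (le_of_eq ?_)
    rw [hJ, Finset.card_empty]
    field_simp
    push_cast
    ring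
  · have h1 := CBoomerang.cBCT_mul_le_sub h hN hc hb' hoe
    refine h1.trans (le_of_eq ?_)
    rw [hJ]
    field_simp
    ring
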